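/- Let $H,K\in(0,1)$ and $\theta>0$. Let $B=\{B_t\}_{t\ge 0}$ be a bifractional Brownian motion with parameters $H,K$ on a probability space $(\Omega,\mathcal F,P)$, i.e. a mean-zero Gaussian process with $$E[B_sB_t]=\frac1{2^{K}}\Big(\big(t^{2H}+s^{2H}\big)^{K}-|t-s|^{2HK}\Big),\qquad s,t\ge 0,$$ and let $X=\{X_t\}_{t\ge0}$ be the Ornstein--Uhlenbeck process driven by $B$, i.e. the process which almost surely has continuous paths and solves $$dX_t=-\theta X_t\,dt+dB_t,\qquad X_0=0,$$ meaning that almost surely $X_t=-\theta\int_0^tX_s\,ds+B_t-B_0$ for all $t\ge0$ (in particular, $B$ has almost surely continuous paths). For $n\ge1$ put $$\hat f_n(X)=\frac1n\sum_{i=1}^nX_i^2 .$$ Then, almost surely as $n\to\infty$, $$\hat f_n(X)\longrightarrow f_{H,K}(\theta):=\frac{2^{1-K}HK\,\Gamma(2HK)}{\theta^{2HK}} .$$ -/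

import Mathlib

open MeasureTheory ProbabilityTheory Filter Topology
open scoped NNReal

/-- `B` is a bifractional Brownian motion with parameters `H` and `K` under `P`: a mean-zero
Gaussian process indexed by `[0, ∞)` with
`E[B_s B_t] = 2^{-K} ((t^{2H} + s^{2H})^K - |t - s|^{2HK})`. -/
structure IsBifractionalBM {Ω : Type*} [MeasurableSpace Ω] (P : Measure Ω) (H K : ℝ)
    (B : ℝ≥0 → Ω → ℝ) : Prop where
  isGaussian : IsGaussianProcess B P
  mean_zero : ∀ t : ℝ≥0, ∫ ω, B t ω ∂P = 0
  cov_eq : ∀ s t : ℝ≥0, ∫ ω, B s ω * B t ω ∂P =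
    1 / (2 : ℝ) ^ K *
      (((t : ℝ) ^ (2 * H) + (s : ℝ) ^ (2 * H)) ^ K - |(t : ℝ) - (s : ℝ)| ^ (2 * H * K))

/-- The continuous path `x` on `[0, ∞)` solves `dx_t = -θ x_t dt + dg_t`, `x_0 = 0`, i.e.
`x_t = -θ ∫_0^t x_s ds + (g_t - g_0)` for all `t ≥ 0` (at `t = 0` this says `x_0 = 0`). -/
structure IsOUPath (θ : ℝ) (g x : ℝ≥0 → ℝ) : Prop where
  continuous_path : Continuous x
  integral_eq : ∀ t : ℝ≥0,
    x t = -θ * (∫ s in (0 : ℝ)..(t : ℝ), x s.toNNReal) + (g t - g 0)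

/-- `X` is the Ornstein-Uhlenbeck process driven by `G`: almost surely its path is continuous and
solves `dX_t = -θ X_t dt + dG_t`, `X_0 = 0`. -/
def IsOUProcess {Ω : Type*} [MeasurableSpace Ω] (P : Measure Ω) (θ : ℝ)
    (G X : ℝ≥0 → Ω → ℝ) : Prop :=
  ∀ᵐ ω ∂P, IsOUPath θ (fun t => G t ω) (fun t => X t ω)

/-- The quadratic estimator `(1/n) ∑_{i=1}^n X_i^2` built on the observations `X_1, …, X_n`. -/
noncomputable def quadraticEstimator {Ω : Type*} (X : ℝ≥0 → Ω → ℝ) (n : ℕ) (ω : Ω) : ℝ :=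
  1 / (n : ℝ) * ∑ i ∈ Finset.Icc 1 n, (X (i : ℝ≥0) ω) ^ 2

/-- `f_{H,K}(θ) = 2^{1-K} H K Γ(2HK) / θ^{2HK}`. -/
noncomputable def asymptoticVarianceHK (H K θ : ℝ) : ℝ :=
  (2 : ℝ) ^ (1 - K) * H * K * Real.Gamma (2 * H * K) / θ ^ (2 * H * K)

/-! ### Fourth moments and Wick's formula for centred Gaussian processes. -/

section GaussianMoments

/-! Variation of constants turns the equation into an average: `X t` is the mean of `B t - B (t -
r)` over an exponential lag `r` of rate `θ`, with `t - r` truncated at `0`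
(`IsOUPath.eq_integral_expMeasure`). Second moments of `X` thus become averages, over two
independent exponential lags, of rectangular increments of the covariance of `B`. To stay within
finite linear combinations of values of `B`, the lags are rounded to a grid (`ouApprox`); every
moment bound is proved for these Gaussian approximants uniformly in the mesh, then passed to `X` by
Fatou.

The variances converge: far from the origin the increments of `(t^(2H) + s^(2H))^K` vanish and only
the stationary part survives, `2^(-K) (r^p + r'^p - |r - r'|^p)` with `p = 2HK`. By memorylessness
`|r - r'|` has the same `p`-th moment as `r`, so the limit is `2^(-K) Γ(p + 1) / θ^p`, the claimed
value.

Fluctuations are controlled by Wick's formula, `Cov(Y², Z²) = 2 Cov(Y, Z)²`, and the decay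
`|Cov(X_i, X_j)| ≤ C ((j - i)^(HK-1) + i^(HK-1))` for `i < j`, which comes from the mixed second
derivative of the covariance (`abs_rectIncr_bifracCov_le_decay`). The centred sum of `n` squares
then has second moment `O(n^(1+HK))`. As `HK < 1`, the averages converge almost surely along the
subsequence `(k+1)^q` for large `q`, and monotonicity of the partial sums of squares fills the gaps
(`ae_tendsto_average_of_lintegral_sq_le`). -/

theorem integral_pow_four_gaussianReal (v : ℝ≥0) :
    ∫ x, x ^ 4 ∂(gaussianReal 0 v) = 3 * (v : ℝ) ^ 2 := by
  have h := iteratedDeriv_mgf_zero (X := id) (μ := gaussianReal 0 v) (by simp) 4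
  have h0 : (gaussianReal 0 v)[(id : ℝ → ℝ) ^ 4] = ∫ x, x ^ 4 ∂(gaussianReal 0 v) := by simp
  rw [← h0, ← h, mgf_id_gaussianReal]
  simp only [iteratedDeriv_succ', iteratedDeriv_zero, zero_mul, zero_add]
  have hE : ∀ t : ℝ, HasDerivAt (fun t : ℝ => Real.exp (v * t ^ 2 / 2))
      (v * t * Real.exp (v * t ^ 2 / 2)) t := fun t => by
    refine (((hasDerivAt_pow 2 t).const_mul (v : ℝ)).div_const 2).exp.congr_deriv ?_
    simp only [Nat.add_one_sub_one, pow_one, Nat.cast_ofNat]; ring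
  -- Differentiating `p · exp(v t²/2)` replaces the prefactor `p` by `p' + v t p`, so the fourth
  -- derivative of the moment generating function is found by iterating on polynomials.
  have hP : ∀ (p q : ℝ → ℝ), (∀ t, HasDerivAt p (q t) t) →
      deriv (fun t : ℝ => p t * Real.exp (v * t ^ 2 / 2)) =
        fun t => (q t + v * t * p t) * Real.exp (v * t ^ 2 / 2) := fun p q hp => by
    funext t
    rw [((hp t).fun_mul (hE t)).deriv]
    ring
  have h1 : deriv (fun t : ℝ => Real.exp (v * t ^ 2 / 2)) =
      fun t => (v * t) * Real.exp (v * t ^ 2 / 2) := funext fun t => (hE t).deriv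
  rw [h1, hP (fun t => v * t) (fun _ => v) fun t => by simpa using (hasDerivAt_id t).const_mul (v : ℝ)]
  have h2 : ∀ t : ℝ, HasDerivAt (fun t : ℝ => v + v * t * (v * t)) (2 * v ^ 2 * t) t := fun t => by
    have e : (fun t : ℝ => v + v * t * (v * t)) = fun t : ℝ => (v : ℝ) + v ^ 2 * t ^ 2 := by
      funext t; ring
    rw [e]
    refine (((hasDerivAt_pow 2 t).const_mul ((v : ℝ) ^ 2)).const_add (v : ℝ)).congr_deriv ?_
    simp only [Nat.add_one_sub_one, pow_one, Nat.cast_ofNat]; ring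
  have h3 : ∀ t : ℝ, HasDerivAt (fun t : ℝ => 2 * v ^ 2 * t + v * t * (v + v * t * (v * t)))
      (3 * v ^ 2 + 3 * v ^ 3 * t ^ 2) t := fun t => by
    have e : (fun t : ℝ => 2 * v ^ 2 * t + v * t * (v + v * t * (v * t))) =
        fun t : ℝ => 3 * (v : ℝ) ^ 2 * t + v ^ 3 * t ^ 3 := by
      funext t; ring
    rw [e]
    refine (((hasDerivAt_id' t).const_mul (3 * (v : ℝ) ^ 2)).fun_add
      ((hasDerivAt_pow 3 t).const_mul ((v : ℝ) ^ 3))).congr_deriv ?_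
    simp only [Nat.add_one_sub_one, Nat.cast_ofNat]; ring
  rw [hP _ _ h2, hP _ _ h3]
  simp

variable {Ω T : Type*} [MeasurableSpace Ω] {P : Measure Ω}

theorem MeasureTheory.Integrable.sub_fun {f g : Ω → ℝ} (hf : Integrable f P)
    (hg : Integrable g P) : Integrable (fun ω => f ω - g ω) P :=
  hf.sub hg

theorem ProbabilityTheory.HasGaussianLaw.integrable_pow {Z : Ω → ℝ} (hZ : HasGaussianLaw Z P)
    {n : ℕ} (hn : Even n) (hn0 : n ≠ 0) : Integrable (fun ω => Z ω ^ n) P := by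
  have h := (hZ.memLp (p := n) (by simp)).integrable_norm_pow hn0
  simpa [hn.pow_abs] using h

theorem ProbabilityTheory.HasGaussianLaw.integral_pow_four {Z : Ω → ℝ} (hZ : HasGaussianLaw Z P)
    (h0 : ∫ ω, Z ω ∂P = 0) : ∫ ω, Z ω ^ 4 ∂P = 3 * (∫ ω, Z ω ^ 2 ∂P) ^ 2 := by
  have := hZ.isProbabilityMeasure
  have h1 : ∫ ω, Z ω ^ 4 ∂P = ∫ x, x ^ 4 ∂(P.map Z) := by
    rw [integral_map hZ.aemeasurable (by fun_prop)]
  rw [h1, hZ.map_eq_gaussianReal, h0, integral_pow_four_gaussianReal,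
    variance_of_integral_eq_zero hZ.aemeasurable h0, Real.coe_toNNReal _ (by positivity)]

variable {Y : T → Ω → ℝ}

theorem ProbabilityTheory.IsGaussianProcess.integrable_mul (hY : IsGaussianProcess Y P) (s t : T) :
    Integrable (fun ω => Y s ω * Y t ω) P :=
  (hY.hasGaussianLaw_eval s).memLp_two.integrable_mul (hY.hasGaussianLaw_eval t).memLp_two

/-- Reduces the mixed fourth moment to fourth moments of single linear combinations, each of which
is one-dimensional Gaussian. -/
theorem sq_mul_sq_eq_polarization (a b : ℝ) :
    a ^ 2 * b ^ 2 = 1 / 12 * ((a + b) ^ 4 + (a - b) ^ 4 - 2 * a ^ 4 - 2 * b ^ 4) := by ring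

theorem ProbabilityTheory.IsGaussianProcess.integrable_sq_mul_sq (hY : IsGaussianProcess Y P)
    (s t : T) : Integrable (fun ω => Y s ω ^ 2 * Y t ω ^ 2) P := by
  simp only [sq_mul_sq_eq_polarization]
  have e4 : Even 4 := ⟨2, rfl⟩
  exact (((((hY.hasGaussianLaw_fun_add (s := s) (t := t)).integrable_pow e4 (by simp)).fun_add
    ((hY.hasGaussianLaw_fun_sub (s := s) (t := t)).integrable_pow e4 (by simp))).sub_fun
    (((hY.hasGaussianLaw_eval s).integrable_pow e4 (by simp)).const_mul 2)).sub_fun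
    (((hY.hasGaussianLaw_eval t).integrable_pow e4 (by simp)).const_mul 2)).const_mul _

/-- Wick's formula for the fourth mixed moment of a centred Gaussian process. -/
theorem ProbabilityTheory.IsGaussianProcess.integral_sq_mul_sq (hY : IsGaussianProcess Y P)
    (h0 : ∀ t, ∫ ω, Y t ω ∂P = 0) (s t : T) :
    ∫ ω, Y s ω ^ 2 * Y t ω ^ 2 ∂P =
      (∫ ω, Y s ω ^ 2 ∂P) * (∫ ω, Y t ω ^ 2 ∂P) + 2 * (∫ ω, Y s ω * Y t ω ∂P) ^ 2 := by
  have e4 : Even 4 := ⟨2, rfl⟩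
  have hs := hY.hasGaussianLaw_eval s
  have ht := hY.hasGaussianLaw_eval t
  have ha := hY.hasGaussianLaw_fun_add (s := s) (t := t)
  have hd := hY.hasGaussianLaw_fun_sub (s := s) (t := t)
  have is2 := hs.integrable_pow (n := 2) even_two (by simp)
  have it2 := ht.integrable_pow (n := 2) even_two (by simp)
  have ist := hY.integrable_mul s t
  have a2 : ∫ ω, (Y s ω + Y t ω) ^ 2 ∂P =
      ∫ ω, Y s ω ^ 2 ∂P + 2 * ∫ ω, Y s ω * Y t ω ∂P + ∫ ω, Y t ω ^ 2 ∂P := by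
    rw [← integral_const_mul, ← integral_add is2 (ist.const_mul 2),
      ← integral_add (is2.fun_add (ist.const_mul 2)) it2]
    congr 1; funext ω; ring
  have d2 : ∫ ω, (Y s ω - Y t ω) ^ 2 ∂P =
      ∫ ω, Y s ω ^ 2 ∂P - 2 * ∫ ω, Y s ω * Y t ω ∂P + ∫ ω, Y t ω ^ 2 ∂P := by
    rw [← integral_const_mul, ← integral_sub is2 (ist.const_mul 2),
      ← integral_add (is2.sub_fun (ist.const_mul 2)) it2]
    congr 1; funext ω; ring
  have a4 := ha.integral_pow_four (by rw [integral_add hs.integrable ht.integrable, h0, h0, add_zero])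
  have d4 := hd.integral_pow_four (by rw [integral_sub hs.integrable ht.integrable, h0, h0, sub_zero])
  have s4 := hs.integral_pow_four (h0 s)
  have t4 := ht.integral_pow_four (h0 t)
  simp only [sq_mul_sq_eq_polarization]
  have ja := ha.integrable_pow e4 (by simp)
  have jd := hd.integrable_pow e4 (by simp)
  have js := (hs.integrable_pow e4 (by simp)).const_mul 2
  have jt := (ht.integrable_pow e4 (by simp)).const_mul 2
  rw [integral_const_mul, integral_sub ((ja.fun_add jd).sub_fun js) jt, integral_sub (ja.fun_add jd) js,
    integral_add ja jd, integral_const_mul, integral_const_mul, a4, d4, s4, t4, a2, d2]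
  ring

theorem ProbabilityTheory.IsGaussianProcess.integrable_mul_centered_sq
    (hY : IsGaussianProcess Y P) (a b : ℝ) (s t : T) :
    Integrable (fun ω => (Y s ω ^ 2 - a) * (Y t ω ^ 2 - b)) P := by
  have := hY.isProbabilityMeasure
  have is2 := (hY.hasGaussianLaw_eval s).integrable_pow (n := 2) even_two (by simp)
  have it2 := (hY.hasGaussianLaw_eval t).integrable_pow (n := 2) even_two (by simp)
  have e : (fun ω => (Y s ω ^ 2 - a) * (Y t ω ^ 2 - b)) =
      fun ω => Y s ω ^ 2 * Y t ω ^ 2 - b * Y s ω ^ 2 - a * Y t ω ^ 2 + a * b := by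
    funext ω; ring
  rw [e]
  exact (((hY.integrable_sq_mul_sq s t).sub_fun (is2.const_mul b)).sub_fun (it2.const_mul a)).fun_add
    (integrable_const _)

theorem ProbabilityTheory.IsGaussianProcess.integral_mul_centered_sq (hY : IsGaussianProcess Y P)
    (h0 : ∀ t, ∫ ω, Y t ω ∂P = 0) (s t : T) :
    ∫ ω, (Y s ω ^ 2 - ∫ ω, Y s ω ^ 2 ∂P) * (Y t ω ^ 2 - ∫ ω, Y t ω ^ 2 ∂P) ∂P =
      2 * (∫ ω, Y s ω * Y t ω ∂P) ^ 2 := by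
  have := hY.isProbabilityMeasure
  have is2 := (hY.hasGaussianLaw_eval s).integrable_pow (n := 2) even_two (by simp)
  have it2 := (hY.hasGaussianLaw_eval t).integrable_pow (n := 2) even_two (by simp)
  have ist := hY.integrable_sq_mul_sq s t
  have hw := hY.integral_sq_mul_sq h0 s t
  set a := ∫ ω, Y s ω ^ 2 ∂P
  set b := ∫ ω, Y t ω ^ 2 ∂P
  have e : (fun ω => (Y s ω ^ 2 - a) * (Y t ω ^ 2 - b)) =
      fun ω => Y s ω ^ 2 * Y t ω ^ 2 - b * Y s ω ^ 2 - a * Y t ω ^ 2 + a * b := by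
    funext ω; ring
  rw [e, integral_add ((ist.sub_fun (is2.const_mul b)).sub_fun (it2.const_mul a)) (integrable_const _),
    integral_sub (ist.sub_fun (is2.const_mul b)) (it2.const_mul a), integral_sub ist (is2.const_mul b),
    integral_const_mul, integral_const_mul, hw]
  simp only [integral_const, probReal_univ, one_smul]
  change a * b + _ - b * a - a * b + a * b = _
  ring

theorem ProbabilityTheory.IsGaussianProcess.integrable_sum_centered_sq
    (hY : IsGaussianProcess Y P) (a : T → ℝ) (I : Finset T) :
    Integrable (fun ω => (∑ i ∈ I, (Y i ω ^ 2 - a i)) ^ 2) P := by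
  simp only [pow_two (∑ i ∈ I, _), Finset.sum_mul_sum]
  exact integrable_finsetSum _ fun i _ => integrable_finsetSum _ fun j _ =>
    hY.integrable_mul_centered_sq _ _ i j

theorem ProbabilityTheory.IsGaussianProcess.integral_sum_centered_sq
    (hY : IsGaussianProcess Y P) (h0 : ∀ t, ∫ ω, Y t ω ∂P = 0) (I : Finset T) :
    ∫ ω, (∑ i ∈ I, (Y i ω ^ 2 - ∫ ω, Y i ω ^ 2 ∂P)) ^ 2 ∂P =
      ∑ i ∈ I, ∑ j ∈ I, 2 * (∫ ω, Y i ω * Y j ω ∂P) ^ 2 := by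
  simp only [pow_two (∑ i ∈ I, _), Finset.sum_mul_sum]
  rw [integral_finsetSum _ fun i _ => integrable_finsetSum _ fun j _ =>
    hY.integrable_mul_centered_sq _ _ i j]
  refine Finset.sum_congr rfl fun i _ => ?_
  rw [integral_finsetSum _ fun j _ => hY.integrable_mul_centered_sq _ _ i j]
  exact Finset.sum_congr rfl fun j _ => hY.integral_mul_centered_sq h0 i j

end GaussianMoments

/-! ### Rectangular increments of the covariance. -/

section Kernel

/-- The covariance function of bifractional Brownian motion. -/
noncomputable def bifracCov (H K s t : ℝ) : ℝ :=
  1 / (2 : ℝ) ^ K * ((t ^ (2 * H) + s ^ (2 * H)) ^ K - |t - s| ^ (2 * H * K))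

/-- The increment of `f` over the rectangle `[s - r, s] × [t - r', t]`. -/
def rectIncr (f : ℝ → ℝ → ℝ) (s t r r' : ℝ) : ℝ :=
  f s t - f s (t - r') - f (s - r) t + f (s - r) (t - r')

/-- The mean value inequality, applied once in each variable. -/
theorem abs_rectIncr_le {f f₁ f₁₂ : ℝ → ℝ → ℝ} {s t r r' M : ℝ} (hr : 0 ≤ r) (hr' : 0 ≤ r')
    (h₁ : ∀ x ∈ Set.Icc (s - r) s, ∀ y ∈ Set.Icc (t - r') t,
      HasDerivAt (fun x => f x y) (f₁ x y) x)
    (h₂ : ∀ x ∈ Set.Icc (s - r) s, ∀ y ∈ Set.Icc (t - r') t,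
      HasDerivAt (fun y => f₁ x y) (f₁₂ x y) y)
    (hM : ∀ x ∈ Set.Icc (s - r) s, ∀ y ∈ Set.Icc (t - r') t, |f₁₂ x y| ≤ M) :
    |rectIncr f s t r r'| ≤ M * r' * r := by
  have ht : t ∈ Set.Icc (t - r') t := ⟨by linarith, le_rfl⟩
  have ht' : t - r' ∈ Set.Icc (t - r') t := ⟨le_rfl, by linarith⟩
  have hs : s ∈ Set.Icc (s - r) s := ⟨by linarith, le_rfl⟩
  have hs' : s - r ∈ Set.Icc (s - r) s := ⟨le_rfl, by linarith⟩
  have key : ∀ x ∈ Set.Icc (s - r) s, ‖f₁ x t - f₁ x (t - r')‖ ≤ M * r' := fun x hx => by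
    have h := (convex_Icc (t - r') t).norm_image_sub_le_of_norm_hasDerivWithin_le
      (fun y hy => (h₂ x hx y hy).hasDerivWithinAt) (fun y hy => hM x hx y hy) ht' ht
    simpa [abs_of_nonneg hr'] using h
  have h := (convex_Icc (s - r) s).norm_image_sub_le_of_norm_hasDerivWithin_le
    (fun x hx => ((h₁ x hx t ht).fun_sub (h₁ x hx (t - r') ht')).hasDerivWithinAt) key hs' hs
  have e : rectIncr f s t r r' =
      f s t - f s (t - r') - (f (s - r) t - f (s - r) (t - r')) := by
    unfold rectIncr; ring
  rw [e]
  simpa [abs_of_nonneg hr] using h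

/-- The mixed derivative is bounded by `4 (x y)^(HK-1)`. The exponent is negative, so the worst
point of the rectangle is its lower corner, which lies above `(s/2, t/2)`. -/
theorem abs_rectIncr_add_rpow_le {H K s t r r' : ℝ} (hH : 0 < H ∧ H < 1) (hK : 0 < K ∧ K < 1)
    (hs : 0 < s) (ht : 0 < t) (hr : 0 ≤ r) (hr' : 0 ≤ r') (hrs : r ≤ s / 2) (hrt : r' ≤ t / 2) :
    |rectIncr (fun x y => (y ^ (2 * H) + x ^ (2 * H)) ^ K) s t r r'| ≤
      4 * (s / 2 * (t / 2)) ^ (H * K - 1) * r' * r := by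
  obtain ⟨hH0, hH1⟩ := hH
  obtain ⟨hK0, hK1⟩ := hK
  have hHK : H * K < 1 := by nlinarith
  refine abs_rectIncr_le
    (f₁ := fun x y => 2 * H * x ^ (2 * H - 1) * K * (y ^ (2 * H) + x ^ (2 * H)) ^ (K - 1))
    (f₁₂ := fun x y => 2 * H * x ^ (2 * H - 1) * K *
      (2 * H * y ^ (2 * H - 1) * (K - 1) * (y ^ (2 * H) + x ^ (2 * H)) ^ (K - 1 - 1)))
    hr hr' ?_ ?_ ?_
  · intro x hx y hy
    have hx0 : 0 < x := by linarith [hx.1]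
    have hy0 : 0 < y := by linarith [hy.1]
    have hp : 0 < y ^ (2 * H) + x ^ (2 * H) := by positivity
    exact ((Real.hasDerivAt_rpow_const (Or.inl hx0.ne')).const_add _).rpow_const (Or.inl hp.ne')
  · intro x hx y hy
    have hx0 : 0 < x := by linarith [hx.1]
    have hy0 : 0 < y := by linarith [hy.1]
    have hp : 0 < y ^ (2 * H) + x ^ (2 * H) := by positivity
    exact (((Real.hasDerivAt_rpow_const (Or.inl hy0.ne')).add_const _).rpow_const
      (Or.inl hp.ne')).const_mul _
  · intro x hx y hy
    have hx1 : s / 2 ≤ x := by linarith [hx.1]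
    have hy1 : t / 2 ≤ y := by linarith [hy.1]
    have hx0 : 0 < x := by linarith
    have hy0 : 0 < y := by linarith
    have hp : 0 < y ^ (2 * H) + x ^ (2 * H) := by positivity
    have hxy : 0 < x * y := by positivity
    -- Since `K - 2 < 0`, this lower bound on the base bounds the last factor above; the exponents
    -- then combine as `2H - 1 + H(K - 2) = HK - 1`.
    have amgm : (x * y) ^ H ≤ y ^ (2 * H) + x ^ (2 * H) := by
      rw [Real.mul_rpow hx0.le hy0.le, mul_comm 2 H, Real.rpow_mul hx0.le, Real.rpow_mul hy0.le,
        Real.rpow_two, Real.rpow_two]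
      nlinarith [sq_nonneg (x ^ H - y ^ H), Real.rpow_pos_of_pos hx0 H, Real.rpow_pos_of_pos hy0 H]
    have h1 : (y ^ (2 * H) + x ^ (2 * H)) ^ (K - 1 - 1) ≤ (x * y) ^ (H * (K - 1 - 1)) := by
      rw [Real.rpow_mul hxy.le]
      exact Real.rpow_le_rpow_of_nonpos (by positivity) amgm (by linarith)
    have h2 : x ^ (2 * H - 1) * y ^ (2 * H - 1) * (x * y) ^ (H * (K - 1 - 1)) =
        (x * y) ^ (H * K - 1) := by
      rw [← Real.mul_rpow hx0.le hy0.le, ← Real.rpow_add hxy]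
      congr 1; ring
    have h3 : (x * y) ^ (H * K - 1) ≤ (s / 2 * (t / 2)) ^ (H * K - 1) :=
      Real.rpow_le_rpow_of_nonpos (by positivity) (by gcongr) (by linarith)
    have e : 2 * H * x ^ (2 * H - 1) * K *
        (2 * H * y ^ (2 * H - 1) * (K - 1) * (y ^ (2 * H) + x ^ (2 * H)) ^ (K - 1 - 1)) =
        -(4 * (H * H * K * (1 - K)) * (x ^ (2 * H - 1) * y ^ (2 * H - 1) *
          (y ^ (2 * H) + x ^ (2 * H)) ^ (K - 1 - 1))) := by ring
    have hK2 : 0 ≤ 1 - K := by linarith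
    rw [e, abs_neg, abs_of_nonneg (by positivity)]
    have hc : H * H * K * (1 - K) ≤ 1 := by
      have a1 : H * H ≤ 1 := by nlinarith
      have a2 : K * (1 - K) ≤ 1 := by nlinarith
      have a3 : 0 ≤ K * (1 - K) := by positivity
      nlinarith
    calc 4 * (H * H * K * (1 - K)) * (x ^ (2 * H - 1) * y ^ (2 * H - 1) *
          (y ^ (2 * H) + x ^ (2 * H)) ^ (K - 1 - 1))
        ≤ 4 * 1 * (x ^ (2 * H - 1) * y ^ (2 * H - 1) * (x * y) ^ (H * (K - 1 - 1))) := by gcongr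
      _ ≤ 4 * (s / 2 * (t / 2)) ^ (H * K - 1) := by rw [h2, mul_one]; gcongr

/-- Only `r'` brings the two time intervals closer; with `r' ≤ (t - s)/2` they stay `(t - s)/2`
apart, away from the singularity of the mixed derivative. -/
theorem abs_rectIncr_abs_rpow_le {p s t r r' : ℝ} (hp : 0 < p ∧ p < 2)
    (hst : s < t) (hr : 0 ≤ r) (hr' : 0 ≤ r') (hd : r' ≤ (t - s) / 2) :
    |rectIncr (fun x y => |y - x| ^ p) s t r r'| ≤ 2 * ((t - s) / 2) ^ (p - 2) * r' * r := by
  have e : rectIncr (fun x y => |y - x| ^ p) s t r r' =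
      rectIncr (fun x y => (y - x) ^ p) s t r r' := by
    unfold rectIncr
    simp only
    rw [abs_of_nonneg (by linarith : 0 ≤ t - s), abs_of_nonneg (by linarith : 0 ≤ t - r' - s),
      abs_of_nonneg (by linarith : 0 ≤ t - (s - r)),
      abs_of_nonneg (by linarith : 0 ≤ t - r' - (s - r))]
  rw [e]
  refine abs_rectIncr_le (f₁ := fun x y => -1 * p * (y - x) ^ (p - 1))
    (f₁₂ := fun x y => -1 * p * (1 * (p - 1) * (y - x) ^ (p - 1 - 1))) hr hr' ?_ ?_ ?_
  · intro x hx y hy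
    have : 0 < y - x := by linarith [hx.2, hy.1]
    exact ((hasDerivAt_id' x).const_sub y).rpow_const (Or.inl this.ne')
  · intro x hx y hy
    have : 0 < y - x := by linarith [hx.2, hy.1]
    exact (((hasDerivAt_id' y).sub_const x).rpow_const (Or.inl this.ne')).const_mul _
  · intro x hx y hy
    have h0 : (t - s) / 2 ≤ y - x := by linarith [hx.2, hy.1]
    have h1 : (y - x) ^ (p - 2) ≤ ((t - s) / 2) ^ (p - 2) :=
      Real.rpow_le_rpow_of_nonpos (by linarith) h0 (by linarith)
    have h2 : 0 ≤ (y - x) ^ (p - 2) := Real.rpow_nonneg (by linarith) _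
    have h3 : |p - 1| ≤ 1 := abs_le.2 ⟨by linarith, by linarith⟩
    rw [show p - 1 - 1 = p - 2 by ring, abs_mul, abs_mul, abs_mul, abs_of_pos hp.1,
      abs_of_nonneg h2]
    simp only [abs_neg, abs_one, one_mul]
    calc p * (|p - 1| * (y - x) ^ (p - 2)) ≤ 2 * (1 * ((t - s) / 2) ^ (p - 2)) := by
          have := hp.1.le; have := hp.2.le; gcongr
      _ = _ := by ring

theorem rectIncr_bifracCov (H K s t r r' : ℝ) :
    rectIncr (bifracCov H K) s t r r' = 1 / (2 : ℝ) ^ K *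
      (rectIncr (fun x y => (y ^ (2 * H) + x ^ (2 * H)) ^ K) s t r r' -
        rectIncr (fun x y => |y - x| ^ (2 * H * K)) s t r r') := by
  unfold rectIncr bifracCov; ring

/-- For fixed lags the non-stationary term is `O(n^(2HK-2))`, while the increment of `|t - s|^(2HK)`
on the diagonal does not depend on `n`. -/
theorem tendsto_rectIncr_bifracCov_diag {H K r r' : ℝ} (hH : 0 < H ∧ H < 1) (hK : 0 < K ∧ K < 1)
    (hr : 0 ≤ r) (hr' : 0 ≤ r') :
    Tendsto (fun n : ℕ => rectIncr (bifracCov H K) n n r r') atTop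
      (𝓝 (1 / (2 : ℝ) ^ K *
        (r ^ (2 * H * K) + r' ^ (2 * H * K) - |r - r'| ^ (2 * H * K)))) := by
  have hHK : H * K < 1 := by nlinarith [hH.1, hH.2, hK.1, hK.2]
  have hp : 0 < 2 * H * K := mul_pos (mul_pos two_pos hH.1) hK.1
  have hA : Tendsto (fun n : ℕ => rectIncr (fun x y => (y ^ (2 * H) + x ^ (2 * H)) ^ K) n n r r')
      atTop (𝓝 0) := by
    have hlim : Tendsto (fun n : ℕ => 4 * ((n : ℝ) / 2 * ((n : ℝ) / 2)) ^ (H * K - 1) * r' * r)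
        atTop (𝓝 0) := by
      have h1 : Tendsto (fun n : ℕ => (n : ℝ) / 2 * ((n : ℝ) / 2)) atTop atTop := by
        have h2 : Tendsto (fun n : ℕ => (n : ℝ) / 2) atTop atTop :=
          tendsto_natCast_atTop_atTop.atTop_div_const two_pos
        exact h2.atTop_mul_atTop₀ h2
      have h2 := (tendsto_rpow_neg_atTop (y := 1 - H * K) (by linarith)).comp h1
      have h3 := ((h2.const_mul 4).mul_const r').mul_const r
      simpa [Function.comp_def, neg_sub] using h3
    refine squeeze_zero_norm' ?_ hlim
    filter_upwards [eventually_ge_atTop ⌈2 * r + 2 * r' + 1⌉₊] with n hn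
    have hn' : 2 * r + 2 * r' + 1 ≤ n := Nat.ceil_le.1 hn
    exact abs_rectIncr_add_rpow_le hH hK (by linarith) (by linarith) hr hr' (by linarith)
      (by linarith)
  have hD : ∀ n : ℕ, rectIncr (fun x y => |y - x| ^ (2 * H * K)) n n r r' =
      -(r ^ (2 * H * K) + r' ^ (2 * H * K) - |r - r'| ^ (2 * H * K)) := fun n => by
    unfold rectIncr
    simp only [sub_self, abs_zero, Real.zero_rpow hp.ne']
    rw [show (n : ℝ) - r' - n = -r' by ring, show (n : ℝ) - (n - r) = r by ring,
      show (n : ℝ) - r' - (n - r) = r - r' by ring, abs_neg, abs_of_nonneg hr, abs_of_nonneg hr']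
    ring
  simp only [rectIncr_bifracCov, hD, sub_neg_eq_add]
  simpa using (hA.add_const _).const_mul (1 / (2 : ℝ) ^ K)

end Kernel

/-! ### Decay and growth bounds for covariances of increments. -/

section KernelBounds

theorem rpow_add_rpow_le {p r r' : ℝ} (hp : 0 < p ∧ p < 2) (hr : 0 ≤ r) (hr' : 0 ≤ r') :
    r ^ p + r' ^ p ≤ 2 * (1 + r) ^ 2 * (1 + r') ^ 2 := by
  have h : ∀ x : ℝ, 0 ≤ x → x ^ p ≤ (1 + x) ^ 2 := fun x hx => by
    calc x ^ p ≤ (1 + x) ^ p := Real.rpow_le_rpow hx (by linarith) hp.1.le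
      _ ≤ (1 + x) ^ (2 : ℝ) := Real.rpow_le_rpow_of_exponent_le (by linarith) hp.2.le
      _ = _ := Real.rpow_two _
  have h1 := h r hr
  have h2 := h r' hr'
  have h3 : 1 ≤ (1 + r) ^ 2 := one_le_pow₀ (by linarith)
  have h4 : 1 ≤ (1 + r') ^ 2 := one_le_pow₀ (by linarith)
  nlinarith

/-- A lag exceeding `s/2` pays for the factor `s^(h-1)` with one extra power of `1 + r`, harmless
after exponential averaging. -/
theorem one_le_two_mul_mul_rpow {h s r : ℝ} (h0 : 0 < h) (hs : 1 ≤ s) (hr : s / 2 < r) :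
    1 ≤ 2 * (1 + r) * s ^ (h - 1) := by
  have h1 : s ^ (1 - h) ≤ 2 * (1 + r) := by
    calc s ^ (1 - h) ≤ s ^ (1 : ℝ) := Real.rpow_le_rpow_of_exponent_le hs (by linarith)
      _ = s := Real.rpow_one s
      _ ≤ _ := by linarith
  have h2 : s ^ (1 - h) * s ^ (h - 1) = 1 := by
    rw [← Real.rpow_add (by linarith)]; simp
  have h3 : 0 ≤ s ^ (h - 1) := Real.rpow_nonneg (by linarith) _
  nlinarith

theorem div_four_rpow_le {h x y : ℝ} (hh : 0 < h ∧ h < 1) (hx : 0 < x) (hxy : x / 4 ≤ y) :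
    y ^ (h - 1) ≤ 4 * x ^ (h - 1) := by
  calc y ^ (h - 1) ≤ (x / 4) ^ (h - 1) :=
        Real.rpow_le_rpow_of_nonpos (by positivity) hxy (by linarith)
    _ = (4 : ℝ) ^ (1 - h) * x ^ (h - 1) := by
        rw [Real.div_rpow hx.le (by norm_num), div_eq_mul_inv, ← Real.rpow_neg (by norm_num),
          neg_sub, mul_comm]
    _ ≤ 4 * x ^ (h - 1) := by
        gcongr
        calc (4 : ℝ) ^ (1 - h) ≤ (4 : ℝ) ^ (1 : ℝ) :=
              Real.rpow_le_rpow_of_exponent_le (by norm_num) (by linarith [hh.1])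
          _ = 4 := Real.rpow_one _

/-- Short lags are handled by the derivative bounds; a lag comparable with `s` or `t - s` is handled
by the crude bound `hb`, trading a polynomial weight in the lags for decay. -/
theorem abs_rectIncr_bifracCov_le_decay {H K s t r r' : ℝ} (hH : 0 < H ∧ H < 1)
    (hK : 0 < K ∧ K < 1) (hs : 1 ≤ s) (hst : s + 1 ≤ t) (hr : 0 ≤ r) (hr' : 0 ≤ r')
    (hb : |rectIncr (bifracCov H K) s t r r'| ≤ r ^ (2 * H * K) + r' ^ (2 * H * K)) :
    |rectIncr (bifracCov H K) s t r r'| ≤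
      16 * ((t - s) ^ (H * K - 1) + s ^ (H * K - 1)) * ((1 + r) ^ 3 * (1 + r') ^ 3) := by
  have h0 : 0 < H * K := mul_pos hH.1 hK.1
  have h1 : H * K < 1 := by nlinarith [hH.1, hH.2, hK.1, hK.2]
  have hp : 0 < 2 * H * K ∧ 2 * H * K < 2 := ⟨by linarith, by linarith⟩
  have hb' := hb.trans (rpow_add_rpow_le hp hr hr')
  have hd0 : 0 ≤ (t - s) ^ (H * K - 1) := Real.rpow_nonneg (by linarith) _
  have hs0 : 0 ≤ s ^ (H * K - 1) := Real.rpow_nonneg (by linarith) _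
  have e1 : 1 ≤ 1 + r := by linarith
  have e2 : 1 ≤ 1 + r' := by linarith
  have f1 : (1 + r) ^ 2 ≤ (1 + r) ^ 3 := pow_le_pow_right₀ e1 (by norm_num)
  have f2 : (1 + r') ^ 2 ≤ (1 + r') ^ 3 := pow_le_pow_right₀ e2 (by norm_num)
  by_cases c1 : s / 2 < r
  · have g := one_le_two_mul_mul_rpow h0 hs c1
    calc _ ≤ 2 * (1 + r) ^ 2 * (1 + r') ^ 2 * 1 := by linarith
      _ ≤ 2 * (1 + r) ^ 2 * (1 + r') ^ 2 * (2 * (1 + r) * s ^ (H * K - 1)) := by gcongr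
      _ = 4 * s ^ (H * K - 1) * ((1 + r) ^ 3 * (1 + r') ^ 2) := by ring
      _ ≤ _ := by gcongr <;> linarith
  by_cases c2 : (t - s) / 2 < r'
  · have g := one_le_two_mul_mul_rpow h0 (by linarith : 1 ≤ t - s) c2
    calc _ ≤ 2 * (1 + r) ^ 2 * (1 + r') ^ 2 * 1 := by linarith
      _ ≤ 2 * (1 + r) ^ 2 * (1 + r') ^ 2 * (2 * (1 + r') * (t - s) ^ (H * K - 1)) := by gcongr
      _ = 4 * (t - s) ^ (H * K - 1) * ((1 + r) ^ 2 * (1 + r') ^ 3) := by ring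
      _ ≤ _ := by gcongr <;> linarith
  have hA := abs_rectIncr_add_rpow_le hH hK (by linarith : 0 < s) (by linarith : 0 < t) hr hr'
    (by linarith) (by linarith)
  have hD := abs_rectIncr_abs_rpow_le hp (by linarith : s < t) hr hr' (by linarith)
  -- Discarding `t ≥ 1` leaves decay in `s` alone, which is all the double sum needs.
  have g1 := div_four_rpow_le ⟨h0, h1⟩ (by linarith : 0 < s)
    (by nlinarith : s / 4 ≤ s / 2 * (t / 2))
  -- The true rate `2HK - 2` is weakened to `HK - 1`, using `t - s ≥ 1`, so that both terms share
  -- one exponent.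
  have g2 : ((t - s) / 2) ^ (2 * H * K - 2) ≤ 4 * (t - s) ^ (H * K - 1) := by
    have : ((t - s) / 2) ^ (2 * H * K - 2) = ((t - s) ^ 2 / 4) ^ (H * K - 1) := by
      rw [show (t - s) ^ 2 / 4 = ((t - s) / 2) ^ (2 : ℝ) by rw [Real.rpow_two]; ring,
        ← Real.rpow_mul (by linarith)]
      congr 1; ring
    rw [this]
    exact div_four_rpow_le ⟨h0, h1⟩ (by linarith) (by nlinarith)
  have hrr : 0 ≤ r' * r := by positivity
  have hrr3 : r' * r ≤ (1 + r) ^ 3 * (1 + r') ^ 3 := by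
    have i1 : r ≤ (1 + r) ^ 3 := by nlinarith [pow_le_pow_right₀ e1 (by norm_num : 1 ≤ 3)]
    have i2 : r' ≤ (1 + r') ^ 3 := by nlinarith [pow_le_pow_right₀ e2 (by norm_num : 1 ≤ 3)]
    rw [mul_comm]; gcongr
  have h2K : 1 / (2 : ℝ) ^ K ≤ 1 := by
    rw [div_le_one (by positivity)]
    exact Real.one_le_rpow (by norm_num) hK.1.le
  have h2K0 : 0 ≤ 1 / (2 : ℝ) ^ K := by positivity
  rw [rectIncr_bifracCov, abs_mul, abs_of_nonneg h2K0]
  refine (mul_le_of_le_one_left (abs_nonneg _) h2K).trans ((abs_sub _ _).trans ?_)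
  calc _ ≤ 4 * (s / 2 * (t / 2)) ^ (H * K - 1) * r' * r +
        2 * ((t - s) / 2) ^ (2 * H * K - 2) * r' * r := add_le_add hA hD
    _ = (4 * (s / 2 * (t / 2)) ^ (H * K - 1) + 2 * ((t - s) / 2) ^ (2 * H * K - 2)) *
        (r' * r) := by ring
    _ ≤ (16 * ((t - s) ^ (H * K - 1) + s ^ (H * K - 1))) * (r' * r) := by
        gcongr; linarith
    _ ≤ _ := by gcongr

variable {Ω : Type*} [MeasurableSpace Ω] {P : Measure Ω} {H K : ℝ} {B : ℝ≥0 → Ω → ℝ}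

theorem IsBifractionalBM.integral_mul (hB : IsBifractionalBM P H K B) (s t : ℝ≥0) :
    ∫ ω, B s ω * B t ω ∂P = bifracCov H K s t := hB.cov_eq s t

theorem IsBifractionalBM.integral_incr_mul_incr (hB : IsBifractionalBM P H K B)
    (s u t v : ℝ≥0) :
    ∫ ω, (B s ω - B u ω) * (B t ω - B v ω) ∂P =
      rectIncr (bifracCov H K) s t (s - u) (t - v) := by
  have I := hB.isGaussian.integrable_mul
  have e : (fun ω => (B s ω - B u ω) * (B t ω - B v ω)) = fun ω =>
      B s ω * B t ω - B s ω * B v ω - B u ω * B t ω + B u ω * B v ω := by funext ω; ring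
  rw [e, integral_add (((I s t).sub_fun (I s v)).sub_fun (I u t)) (I u v),
    integral_sub ((I s t).sub_fun (I s v)) (I u t), integral_sub (I s t) (I s v)]
  simp only [hB.integral_mul, rectIncr, sub_sub_cancel]

/-- Concavity of `x ↦ x^K` gives `(2x)^K + (2y)^K ≤ 2 (x + y)^K`, so the non-stationary part
contributes nonpositively. -/
theorem bifracCov_variance_incr_le {H K s u : ℝ} (hH : 0 < H) (hK : 0 < K ∧ K < 1)
    (hs : 0 ≤ s) (hu : 0 ≤ u) :
    rectIncr (bifracCov H K) s s (s - u) (s - u) ≤ 2 * |s - u| ^ (2 * H * K) := by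
  have hp : 0 < 2 * H * K := by have := hK.1; positivity
  unfold rectIncr bifracCov
  simp only [sub_sub_cancel, sub_self, abs_zero, Real.zero_rpow hp.ne', sub_zero]
  rw [abs_sub_comm u s, add_comm (s ^ (2 * H)) (u ^ (2 * H))]
  set x := s ^ (2 * H)
  set y := u ^ (2 * H)
  have hx : 0 ≤ x := Real.rpow_nonneg hs _
  have hy : 0 ≤ y := Real.rpow_nonneg hu _
  have hc := (Real.concaveOn_rpow hK.1.le hK.2.le).2 (Set.mem_Ici.2 (by positivity : 0 ≤ 2 * x))
    (Set.mem_Ici.2 (by positivity : 0 ≤ 2 * y)) (by norm_num : (0 : ℝ) ≤ 1 / 2)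
    (by norm_num : (0 : ℝ) ≤ 1 / 2) (by norm_num)
  simp only [smul_eq_mul] at hc
  rw [show 1 / 2 * (2 * x) + 1 / 2 * (2 * y) = y + x by ring] at hc
  have h2K : 1 / (2 : ℝ) ^ K ≤ 1 := by
    rw [div_le_one (by positivity)]
    exact Real.one_le_rpow (by norm_num) hK.1.le
  have h2K0 : 0 ≤ 1 / (2 : ℝ) ^ K := by positivity
  have hd : 0 ≤ |s - u| ^ (2 * H * K) := by positivity
  rw [← two_mul, ← two_mul]
  nlinarith [mul_le_mul_of_nonneg_left hc h2K0, mul_le_mul_of_nonneg_right h2K hd]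

/-- The kernel inequality is read off the process: an increment of the covariance is the mean of a
product of increments, and `|ab| ≤ (a² + b²)/2`. -/
theorem IsBifractionalBM.abs_rectIncr_le (hB : IsBifractionalBM P H K B) (hH : 0 < H)
    (hK : 0 < K ∧ K < 1) (s u t v : ℝ≥0) :
    |rectIncr (bifracCov H K) s t (s - u) (t - v)| ≤
      |(s : ℝ) - u| ^ (2 * H * K) + |(t : ℝ) - v| ^ (2 * H * K) := by
  have hv : ∀ s u : ℝ≥0, ∫ ω, (B s ω - B u ω) ^ 2 ∂P ≤ 2 * |(s : ℝ) - u| ^ (2 * H * K) :=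
    fun s u => by
      simp only [pow_two (_ - _)]
      rw [hB.integral_incr_mul_incr s u s u]
      exact bifracCov_variance_incr_le hH hK s.2 u.2
  have hi : ∀ s u : ℝ≥0, Integrable (fun ω => (B s ω - B u ω) ^ 2) P := fun s u =>
    (hB.isGaussian.hasGaussianLaw_fun_sub (s := s) (t := u)).integrable_pow even_two (by simp)
  rw [← hB.integral_incr_mul_incr s u t v]
  calc |∫ ω, (B s ω - B u ω) * (B t ω - B v ω) ∂P|
      ≤ ∫ ω, (1 / 2 * (B s ω - B u ω) ^ 2 + 1 / 2 * (B t ω - B v ω) ^ 2) ∂P := by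
        rw [← Real.norm_eq_abs]
        refine norm_integral_le_of_norm_le (((hi s u).const_mul _).fun_add ((hi t v).const_mul _))
          (ae_of_all _ fun ω => ?_)
        rw [Real.norm_eq_abs, abs_le]
        constructor <;> nlinarith [sq_nonneg (B s ω - B u ω + (B t ω - B v ω)),
          sq_nonneg (B s ω - B u ω - (B t ω - B v ω))]
    _ ≤ _ := by
        rw [integral_add ((hi s u).const_mul _) ((hi t v).const_mul _), integral_const_mul,
          integral_const_mul]
        linarith [hv s u, hv t v]

end KernelBounds

/-! ### Averages over exponential lags. -/

section Exponential

variable {θ : ℝ}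

theorem integral_expMeasure (hθ : 0 < θ) (f : ℝ → ℝ) :
    ∫ r, f r ∂(expMeasure θ) = ∫ r in Set.Ioi 0, θ * Real.exp (-(θ * r)) * f r := by
  have e : expMeasure θ = volume.withDensity (exponentialPDF θ) := rfl
  have hm : Measurable (exponentialPDF θ) := (measurable_exponentialPDFReal θ).ennreal_ofReal
  rw [e, integral_withDensity_eq_integral_toReal_smul hm (ae_of_all _ fun _ => ENNReal.ofReal_lt_top),
    ← integral_Ici_eq_integral_Ioi, ← integral_indicator measurableSet_Ici]
  congr 1
  funext r
  by_cases hr : 0 ≤ r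
  · rw [Set.indicator_of_mem (Set.mem_Ici.2 hr), exponentialPDF_of_nonneg hr,
      ENNReal.toReal_ofReal (by positivity), smul_eq_mul]
  · rw [Set.indicator_of_notMem (by simpa using hr), exponentialPDF_of_neg (not_le.1 hr)]
    simp

theorem integrable_expMeasure_iff (hθ : 0 < θ) (f : ℝ → ℝ) :
    Integrable f (expMeasure θ) ↔
      IntegrableOn (fun r => θ * Real.exp (-(θ * r)) * f r) (Set.Ioi 0) := by
  have e : expMeasure θ = volume.withDensity (exponentialPDF θ) := rfl
  have hm : Measurable (exponentialPDF θ) := (measurable_exponentialPDFReal θ).ennreal_ofReal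
  rw [e, integrable_withDensity_iff_integrable_smul' hm
    (ae_of_all _ fun _ => ENNReal.ofReal_lt_top), ← integrableOn_Ici_iff_integrableOn_Ioi,
    ← integrable_indicator_iff measurableSet_Ici]
  refine integrable_congr (ae_of_all _ fun r => ?_)
  simp only
  by_cases hr : 0 ≤ r
  · rw [Set.indicator_of_mem (Set.mem_Ici.2 hr), exponentialPDF_of_nonneg hr,
      ENNReal.toReal_ofReal (by positivity), smul_eq_mul]
  · rw [Set.indicator_of_notMem (by simpa using hr), exponentialPDF_of_neg (not_le.1 hr)]
    simp

theorem ae_pos_expMeasure (θ : ℝ) : ∀ᵐ r ∂(expMeasure θ), 0 < r := by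
  have e : expMeasure θ = volume.withDensity (exponentialPDF θ) := rfl
  have hm : Measurable (exponentialPDF θ) := (measurable_exponentialPDFReal θ).ennreal_ofReal
  rw [e, ae_withDensity_iff hm]
  have h0 : ∀ᵐ r : ℝ, r ≠ 0 := by simp [ae_iff]
  filter_upwards [h0] with r hr0 hr
  by_contra hneg
  exact hr (exponentialPDF_of_neg (lt_of_le_of_ne (not_lt.1 hneg) hr0))

theorem integrable_rpow_expMeasure (hθ : 0 < θ) {p : ℝ} (hp : 0 < p) :
    Integrable (fun r => r ^ p) (expMeasure θ) := by
  rw [integrable_expMeasure_iff hθ]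
  have h := (integrableOn_rpow_mul_exp_neg_mul_rpow (p := 1) (s := p) (b := θ)
    (by linarith) one_pos hθ).const_mul θ
  refine h.congr (ae_of_all _ fun r => ?_)
  simp only [Real.rpow_one, neg_mul]
  ring

theorem integrable_one_add_pow_expMeasure (hθ : 0 < θ) (k : ℕ) :
    Integrable (fun r => (1 + r) ^ k) (expMeasure θ) := by
  have := isProbabilityMeasure_expMeasure hθ
  have h : ∀ m : ℕ, Integrable (fun r : ℝ => r ^ m) (expMeasure θ) := fun m => by
    rcases Nat.eq_zero_or_pos m with rfl | hm
    · simp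
    · simpa using integrable_rpow_expMeasure hθ (p := m) (by positivity)
  simp only [add_comm (1 : ℝ), add_pow, one_pow, mul_one]
  exact integrable_finsetSum _ fun m _ => (h m).mul_const _

theorem integral_rpow_expMeasure (hθ : 0 < θ) {p : ℝ} (hp : 0 < p) :
    ∫ r, r ^ p ∂(expMeasure θ) = Real.Gamma (p + 1) / θ ^ p := by
  rw [integral_expMeasure hθ]
  have h := Real.integral_rpow_mul_exp_neg_mul_Ioi (a := p + 1) (by linarith) hθ
  have e : ∀ r : ℝ, θ * Real.exp (-(θ * r)) * r ^ p =
      θ * (r ^ (p + 1 - 1) * Real.exp (-(θ * r))) := fun r => by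
    rw [add_sub_cancel_right]; ring
  simp only [e]
  rw [integral_const_mul, h, one_div, Real.inv_rpow hθ.le, Real.rpow_add hθ, Real.rpow_one]
  field_simp

/-- Memorylessness: beyond `a`, the excess `r - a` is again exponential, with total mass `exp(-θ
a)`. -/
theorem setIntegral_Ioi_comp_sub_expMeasure (hθ : 0 < θ) {a : ℝ} (ha : 0 ≤ a) (g : ℝ → ℝ) :
    ∫ r, (Set.Ioi a).indicator (fun r => g (r - a)) r ∂(expMeasure θ) =
      Real.exp (-(θ * a)) * ∫ r, g r ∂(expMeasure θ) := by
  rw [integral_expMeasure hθ, integral_expMeasure hθ, ← integral_const_mul,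
    ← integral_indicator measurableSet_Ioi, ← integral_indicator measurableSet_Ioi,
    ← integral_add_right_eq_self (μ := volume) _ a]
  congr 1
  funext r
  by_cases hr : 0 < r
  · rw [Set.indicator_of_mem (by simp; linarith), Set.indicator_of_mem (by simp [hr]),
      Set.indicator_of_mem (by simpa using hr), add_sub_cancel_right, mul_add, neg_add, Real.exp_add]
    ring
  · rw [Set.indicator_of_notMem (s := Set.Ioi 0) (a := r) (by simpa using hr)]
    by_cases hra : 0 < r + a
    · rw [Set.indicator_of_mem (by simpa using hra), Set.indicator_of_notMem (by simpa using hr),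
        mul_zero]
    · rw [Set.indicator_of_notMem (by simpa using hra)]

theorem integral_exp_neg_expMeasure (hθ : 0 < θ) :
    ∫ r, Real.exp (-(θ * r)) ∂(expMeasure θ) = 1 / 2 := by
  rw [integral_expMeasure hθ]
  have e : ∀ r : ℝ, θ * Real.exp (-(θ * r)) * Real.exp (-(θ * r)) =
      θ * Real.exp ((-(2 * θ)) * r) := fun r => by
    rw [mul_assoc, ← Real.exp_add]; ring_nf
  simp only [e]
  rw [integral_const_mul, integral_exp_mul_Ioi (by linarith)]
  simp
  field_simp

theorem abs_sub_rpow_le {p a b : ℝ} (hp : 0 < p) (ha : 0 ≤ a) (hb : 0 ≤ b) :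
    |a - b| ^ p ≤ a ^ p + b ^ p := by
  rcases le_total a b with h | h
  · rw [abs_sub_comm, abs_of_nonneg (sub_nonneg.2 h)]
    exact (Real.rpow_le_rpow (sub_nonneg.2 h) (by linarith) hp.le).trans
      (le_add_of_nonneg_left (Real.rpow_nonneg ha _))
  · rw [abs_of_nonneg (sub_nonneg.2 h)]
    exact (Real.rpow_le_rpow (sub_nonneg.2 h) (by linarith) hp.le).trans
      (le_add_of_nonneg_right (Real.rpow_nonneg hb _))

theorem ae_nonneg_prod_expMeasure (hθ : 0 < θ) :
    ∀ᵐ z ∂((expMeasure θ).prod (expMeasure θ)), 0 ≤ z.1 ∧ 0 ≤ z.2 := by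
  have := isProbabilityMeasure_expMeasure hθ
  have h := ae_pos_expMeasure θ
  filter_upwards [Measure.quasiMeasurePreserving_fst.ae h,
    Measure.quasiMeasurePreserving_snd.ae h] with z h1 h2
  exact ⟨h1.le, h2.le⟩

theorem integrable_abs_sub_rpow_expMeasure (hθ : 0 < θ) {p : ℝ} (hp : 0 < p) :
    Integrable (fun z : ℝ × ℝ => |z.1 - z.2| ^ p) ((expMeasure θ).prod (expMeasure θ)) := by
  have := isProbabilityMeasure_expMeasure hθ
  have hi := integrable_rpow_expMeasure hθ hp
  refine ((hi.comp_fst (expMeasure θ)).add (hi.comp_snd (expMeasure θ))).mono'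
    (by have h0 := hp.le; fun_prop (disch := assumption)) ?_
  filter_upwards [ae_nonneg_prod_expMeasure hθ] with z hz
  rw [Real.norm_of_nonneg (by positivity)]
  exact abs_sub_rpow_le hp hz.1 hz.2

/-- By symmetry, twice the part where the first lag is larger. There, memorylessness makes the
excess over the second lag exponential, and the factor `exp(-θ b)` averages to `1/2`. -/
theorem integral_abs_sub_rpow_expMeasure (hθ : 0 < θ) {p : ℝ} (hp : 0 < p) :
    ∫ z : ℝ × ℝ, |z.1 - z.2| ^ p ∂((expMeasure θ).prod (expMeasure θ)) =
      ∫ r, r ^ p ∂(expMeasure θ) := by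
  have := isProbabilityMeasure_expMeasure hθ
  have hi := integrable_abs_sub_rpow_expMeasure hθ hp
  set D : Set (ℝ × ℝ) := {z | z.2 < z.1}
  have hD : MeasurableSet D := measurableSet_lt measurable_snd measurable_fst
  have e : ∀ z : ℝ × ℝ, |z.1 - z.2| ^ p =
      D.indicator (fun z => |z.1 - z.2| ^ p) z +
        D.indicator (fun z => |z.1 - z.2| ^ p) z.swap := fun z => by
    rcases lt_trichotomy z.1 z.2 with h | h | h
    · rw [Set.indicator_of_notMem (by simp [D, h.le]), Set.indicator_of_mem (by simpa [D] using h),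
        zero_add, Prod.fst_swap, Prod.snd_swap, abs_sub_comm]
    · rw [Set.indicator_of_notMem (by simp [D, h]), Set.indicator_of_notMem (by simp [D, h]), h]
      simp [Real.zero_rpow hp.ne']
    · rw [Set.indicator_of_mem (by simpa [D] using h), Set.indicator_of_notMem (by simp [D, h.le]),
        add_zero]
  have hF := hi.indicator hD
  have hF2 : ∫ z, D.indicator (fun z => |z.1 - z.2| ^ p) z ∂((expMeasure θ).prod (expMeasure θ)) =
      1 / 2 * ∫ r, r ^ p ∂(expMeasure θ) := by
    rw [integral_prod_symm _ hF]
    have h1 : ∀ᵐ b ∂(expMeasure θ), ∫ a, D.indicator (fun z => |z.1 - z.2| ^ p) (a, b)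
        ∂(expMeasure θ) = Real.exp (-(θ * b)) * ∫ r, r ^ p ∂(expMeasure θ) := by
      filter_upwards [ae_pos_expMeasure θ] with b hb
      rw [← setIntegral_Ioi_comp_sub_expMeasure hθ hb.le]
      congr 1
      funext a
      by_cases h : b < a
      · rw [Set.indicator_of_mem (by simpa [D] using h), Set.indicator_of_mem (by simpa using h),
          abs_of_pos (by simpa using h)]
      · rw [Set.indicator_of_notMem (by simpa [D] using h),
          Set.indicator_of_notMem (by simpa using h)]
    rw [integral_congr_ae h1, integral_mul_const, integral_exp_neg_expMeasure hθ]
  have hS : Integrable (fun z : ℝ × ℝ => D.indicator (fun z => |z.1 - z.2| ^ p) z.swap)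
    ((expMeasure θ).prod (expMeasure θ)) := hF.swap
  rw [integral_congr_ae (ae_of_all _ e), integral_add hF hS, integral_prod_swap (fun z => D.indicator (fun z => |z.1 - z.2| ^ p) z),
    hF2]
  ring

theorem integral_rpow_add_sub_expMeasure (hθ : 0 < θ) {p : ℝ} (hp : 0 < p) :
    ∫ z : ℝ × ℝ, (z.1 ^ p + z.2 ^ p - |z.1 - z.2| ^ p) ∂((expMeasure θ).prod (expMeasure θ)) =
      p * Real.Gamma p / θ ^ p := by
  have := isProbabilityMeasure_expMeasure hθ
  have hi := integrable_rpow_expMeasure hθ hp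
  have h1 := hi.comp_fst (expMeasure θ)
  have h2 := hi.comp_snd (expMeasure θ)
  rw [integral_sub (h1.fun_add h2) (integrable_abs_sub_rpow_expMeasure hθ hp), integral_add h1 h2,
    integral_abs_sub_rpow_expMeasure hθ hp, integral_fun_fst (fun r : ℝ => r ^ p), integral_fun_snd (fun r : ℝ => r ^ p),
    integral_rpow_expMeasure hθ hp, Real.Gamma_add_one hp.ne']
  simp

theorem integral_comp_nat_eq_sum {μ : Measure ℝ} [IsProbabilityMeasure μ] {a : ℝ → ℕ}
    (ha : Measurable a) {M : ℕ} (haM : ∀ r, a r ≤ M) (f : ℕ → ℝ) :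
    ∫ r, f (a r) ∂μ = ∑ k ∈ Finset.range (M + 1), μ.real (a ⁻¹' {k}) * f k := by
  have e : ∀ r, f (a r) =
      ∑ k ∈ Finset.range (M + 1), (a ⁻¹' {k}).indicator (fun _ => f k) r := fun r => by
    rw [Finset.sum_eq_single (a r)]
    · simp
    · intro k _ hk
      exact Set.indicator_of_notMem (by simpa using hk.symm) _
    · intro h
      exact absurd (Finset.mem_range.2 (Nat.lt_succ_of_le (haM r))) h
  have hk : ∀ k, MeasurableSet (a ⁻¹' {k}) := fun k => ha (measurableSet_singleton k)
  simp only [e]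
  rw [integral_finsetSum _ fun k _ => (integrable_const (f k)).indicator (hk k)]
  exact Finset.sum_congr rfl fun k _ => by rw [integral_indicator_const _ (hk k), smul_eq_mul]

theorem integral_prod_comp_nat_eq_sum {μ : Measure ℝ} [IsProbabilityMeasure μ] {a b : ℝ → ℕ}
    (ha : Measurable a) (hb : Measurable b) {M N : ℕ} (haM : ∀ r, a r ≤ M) (hbN : ∀ r, b r ≤ N)
    (f : ℕ → ℕ → ℝ) :
    ∫ z : ℝ × ℝ, f (a z.1) (b z.2) ∂(μ.prod μ) = ∑ k ∈ Finset.range (M + 1),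
      ∑ l ∈ Finset.range (N + 1), μ.real (a ⁻¹' {k}) * μ.real (b ⁻¹' {l}) * f k l := by
  have hi : Integrable (fun z : ℝ × ℝ => f (a z.1) (b z.2)) (μ.prod μ) := by
    have hm : Measurable (fun z : ℝ × ℝ => f (a z.1) (b z.2)) :=
      (measurable_of_countable (fun q : ℕ × ℕ => f q.1 q.2)).comp
        ((ha.comp measurable_fst).prodMk (hb.comp measurable_snd))
    refine Integrable.of_bound hm.aestronglyMeasurable
      (∑ k ∈ Finset.range (M + 1), ∑ l ∈ Finset.range (N + 1), |f k l|) (ae_of_all _ fun z => ?_)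
    have h1 : |f (a z.1) (b z.2)| ≤ ∑ l ∈ Finset.range (N + 1), |f (a z.1) l| :=
      Finset.single_le_sum (f := fun l => |f (a z.1) l|) (fun _ _ => abs_nonneg _)
        (Finset.mem_range.2 (Nat.lt_succ_of_le (hbN z.2)))
    exact h1.trans (Finset.single_le_sum (f := fun k => ∑ l ∈ Finset.range (N + 1), |f k l|)
      (fun _ _ => Finset.sum_nonneg fun _ _ => abs_nonneg _)
        (Finset.mem_range.2 (Nat.lt_succ_of_le (haM z.1))))
  rw [integral_prod _ hi]
  simp only [integral_comp_nat_eq_sum hb hbN (f _)]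
  rw [integral_comp_nat_eq_sum ha haM
    (fun k => ∑ l ∈ Finset.range (N + 1), μ.real (b ⁻¹' {l}) * f k l)]
  refine Finset.sum_congr rfl fun k _ => ?_
  rw [Finset.mul_sum]
  exact Finset.sum_congr rfl fun l _ => by ring

end Exponential

/-! ### Pathwise solution of the Langevin equation. -/

section OUPath

variable {θ : ℝ} {g x : ℝ≥0 → ℝ}

theorem IsOUPath.continuous_driver (h : IsOUPath θ g x) : Continuous g := by
  have hx : Continuous fun s : ℝ => x s.toNNReal := h.continuous_path.comp continuous_real_toNNReal
  have hI : Continuous fun t : ℝ => ∫ s in (0 : ℝ)..t, x s.toNNReal :=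
    intervalIntegral.continuous_primitive (fun a b => hx.intervalIntegrable a b) 0
  have e : g = fun t : ℝ≥0 => x t + θ * (∫ s in (0 : ℝ)..(t : ℝ), x s.toNNReal) + g 0 := by
    funext t
    have := h.integral_eq t
    linarith
  rw [e]
  exact ((h.continuous_path.add ((hI.comp NNReal.continuous_coe).const_mul θ)).add_const _)

/-- Variation of constants, written as an average of increments of the driver over an exponential
time lag. -/
theorem IsOUPath.eq_integral_expMeasure (hθ : 0 < θ) (h : IsOUPath θ g x) (t : ℝ≥0) :
    x t = ∫ r, (g t - g (t - r.toNNReal)) ∂(expMeasure θ) := by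
  have := isProbabilityMeasure_expMeasure hθ
  have hx : Continuous fun s : ℝ => x s.toNNReal := h.continuous_path.comp continuous_real_toNNReal
  set I : ℝ → ℝ := fun t => ∫ s in (0 : ℝ)..t, x s.toNNReal with hIdef
  have hI : ∀ t, HasDerivAt I (x t.toNNReal) t := fun t =>
    intervalIntegral.integral_hasDerivAt_right (hx.intervalIntegrable _ _)
      (hx.stronglyMeasurableAtFilter _ _) hx.continuousAt
  have hIc : Continuous I := continuous_iff_continuousAt.2 fun t => (hI t).continuousAt
  set β : ℝ → ℝ := fun t => x t.toNNReal + θ * I t with hβdef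
  have hβ : Continuous β := hx.add (hIc.const_mul θ)
  have hβg : ∀ s : ℝ≥0, β s = g s - g 0 := fun s => by
    have := h.integral_eq s
    simp only [hβdef, hIdef, Real.toNNReal_coe]
    linarith
  have hβ0 : β 0 = 0 := by simpa using hβg 0
  -- The integrating factor: `I' + θ I = β`, where `β` extends `g - g 0` to the real line.
  have hE : ∀ s : ℝ, HasDerivAt (fun s => Real.exp (θ * s) * I s) (Real.exp (θ * s) * β s) s :=
    fun s => by
      refine ((((hasDerivAt_id' s).const_mul θ).exp).fun_mul (hI s)).congr_deriv ?_
      simp only [hβdef]; ring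
  have hFTC : ∫ s in (0 : ℝ)..t, Real.exp (θ * s) * β s = Real.exp (θ * t) * I t := by
    rw [intervalIntegral.integral_eq_sub_of_hasDerivAt (fun s _ => hE s)
      ((Continuous.mul (by fun_prop) hβ).intervalIntegrable _ _)]
    simp [hIdef]
  have hconv : ∫ r in (0 : ℝ)..t, θ * Real.exp (-(θ * r)) * β (t - r) = θ * I t := by
    have h1 := intervalIntegral.integral_comp_sub_left
      (fun s => θ * Real.exp (-(θ * (t - s))) * β s) (a := 0) (b := t) (t : ℝ)
    simp only [sub_sub_cancel, sub_self, sub_zero] at h1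
    rw [h1]
    have e : ∀ s : ℝ, θ * Real.exp (-(θ * (t - s))) * β s =
        θ * Real.exp (-(θ * t)) * (Real.exp (θ * s) * β s) := fun s => by
      rw [show -(θ * ((t : ℝ) - s)) = -(θ * t) + θ * s by ring, Real.exp_add]; ring
    simp only [e]
    rw [intervalIntegral.integral_const_mul, hFTC, mul_assoc, ← mul_assoc (Real.exp _),
      ← Real.exp_add, neg_add_cancel, Real.exp_zero, one_mul]
  have e1 : ∀ r : ℝ, g t - g (t - r.toNNReal) = β t - β (max (t - max r 0) 0) := fun r => by
    have e2 : max ((t : ℝ) - max r 0) 0 = ((t - r.toNNReal : ℝ≥0) : ℝ) := by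
      rw [NNReal.coe_sub_def, Real.coe_toNNReal']
    rw [e2, hβg, hβg]; ring
  have hm : Continuous fun r : ℝ => β (max ((t : ℝ) - max r 0) 0) := hβ.comp (by fun_prop)
  have hint : Integrable (fun r : ℝ => β (max ((t : ℝ) - max r 0) 0)) (expMeasure θ) := by
    obtain ⟨C, hC⟩ := (isCompact_Icc (a := (0 : ℝ)) (b := t)).exists_bound_of_continuousOn
      hβ.continuousOn
    exact Integrable.of_bound hm.aestronglyMeasurable C (ae_of_all _ fun r =>
      hC _ ⟨le_max_right _ _, max_le (by linarith [le_max_right r 0]) t.2⟩)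
  simp only [e1]
  rw [integral_sub (integrable_const _) hint, integral_const, probReal_univ, one_smul,
    integral_expMeasure hθ]
  -- Lags beyond `t` are truncated to time `0`, where `β` vanishes.
  have e3 : ∫ r in Set.Ioi (0 : ℝ), θ * Real.exp (-(θ * r)) * β (max ((t : ℝ) - max r 0) 0) =
      ∫ r in (0 : ℝ)..t, θ * Real.exp (-(θ * r)) * β (t - r) := by
    rw [intervalIntegral.integral_of_le t.coe_nonneg, ← integral_indicator measurableSet_Ioi,
      ← integral_indicator measurableSet_Ioc]
    congr 1
    funext r
    by_cases hr : 0 < r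
    · rw [Set.indicator_of_mem (Set.mem_Ioi.2 hr), max_eq_left hr.le]
      by_cases hrt : r ≤ t
      · rw [Set.indicator_of_mem (Set.mem_Ioc.2 ⟨hr, hrt⟩), max_eq_left (sub_nonneg.2 hrt)]
      · rw [Set.indicator_of_notMem (fun h => hrt (Set.mem_Ioc.1 h).2), max_eq_right (by linarith), hβ0, mul_zero]
    · rw [Set.indicator_of_notMem (by simpa using hr), Set.indicator_of_notMem (fun h => hr (Set.mem_Ioc.1 h).1)]
  rw [e3, hconv]
  simp [hβdef]

end OUPath

/-! ### Gaussian approximation on a grid of lags. -/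

section Discretization

/-- The time lag `r` rounded down to the grid of mesh `1 / N` and capped at `n`, in units of
`1 / N`. -/
noncomputable def gridLag (N n : ℕ) (r : ℝ) : ℕ := min ⌊r * N⌋₊ (n * N)

theorem measurable_gridLag (N n : ℕ) : Measurable (gridLag N n) :=
  (Nat.measurable_floor.comp (measurable_id.mul_const _)).min measurable_const

theorem gridLag_le (N n : ℕ) (r : ℝ) : gridLag N n r ≤ n * N := min_le_right _ _

theorem div_le_of_le_mul_natCast {N n k : ℕ} (h : k ≤ n * N) : (k : ℝ) / N ≤ n :=
  div_le_of_le_mul₀ (by positivity) (by positivity) (by exact_mod_cast h)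

theorem gridLag_div_le_self (N n : ℕ) {r : ℝ} (hr : 0 ≤ r) : (gridLag N n r : ℝ) / N ≤ r := by
  refine div_le_of_le_mul₀ (by positivity) hr ?_
  calc (gridLag N n r : ℝ) ≤ (⌊r * N⌋₊ : ℝ) := by exact_mod_cast min_le_left _ _
    _ ≤ r * N := Nat.floor_le (by positivity)

theorem tendsto_gridLag_div (n : ℕ) {r : ℝ} (hr : 0 ≤ r) :
    Tendsto (fun N : ℕ => (gridLag N n r : ℝ) / N) atTop (𝓝 (min r n)) := by
  have h1 : Tendsto (fun N : ℕ => (⌊r * N⌋₊ : ℝ) / N) atTop (𝓝 r) :=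
    (tendsto_nat_floor_mul_div_atTop hr).comp tendsto_natCast_atTop_atTop
  refine (h1.min (tendsto_const_nhds (x := (n : ℝ)))).congr' ?_
  filter_upwards [eventually_gt_atTop 0] with N hN
  have hN' : (0 : ℝ) < N := by exact_mod_cast hN
  unfold gridLag
  rw [Nat.cast_min, Nat.cast_mul, ← min_div_div_right hN'.le, mul_div_cancel_right₀ _ hN'.ne']

variable {Ω : Type*}

/-- Approximation of the Ornstein-Uhlenbeck process driven by `B` at time `n` by a linear
combination of the values of `B` on the grid of mesh `1 / N`. -/
noncomputable def ouApprox (θ : ℝ) (B : ℝ≥0 → Ω → ℝ) (N n : ℕ) (ω : Ω) : ℝ :=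
  ∑ k ∈ Finset.range (n * N + 1), (expMeasure θ).real (gridLag N n ⁻¹' {k}) *
    (B n ω - B (n - (k : ℝ≥0) / N) ω)

theorem ouApprox_eq_integral {θ : ℝ} (hθ : 0 < θ) (B : ℝ≥0 → Ω → ℝ) (N n : ℕ) (ω : Ω) :
    ouApprox θ B N n ω =
      ∫ r, (B n ω - B (n - (gridLag N n r : ℝ≥0) / N) ω) ∂(expMeasure θ) := by
  have := isProbabilityMeasure_expMeasure hθ
  exact (integral_comp_nat_eq_sum (measurable_gridLag N n) (gridLag_le N n)
    (fun k => B n ω - B (n - (k : ℝ≥0) / N) ω)).symm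

theorem tendsto_ouApprox {θ : ℝ} (hθ : 0 < θ) {B X : ℝ≥0 → Ω → ℝ} {ω : Ω}
    (h : IsOUPath θ (fun t => B t ω) (fun t => X t ω)) (n : ℕ) :
    Tendsto (fun N => ouApprox θ B N n ω) atTop (𝓝 (X n ω)) := by
  have := isProbabilityMeasure_expMeasure hθ
  have hc := h.continuous_driver
  rw [h.eq_integral_expMeasure hθ n]
  simp only [ouApprox_eq_integral hθ]
  obtain ⟨C, hC⟩ := (isCompact_Icc (a := (0 : ℝ≥0)) (b := n)).exists_bound_of_continuousOn
    (continuous_const.sub hc : Continuous fun t => B n ω - B t ω).continuousOn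
  refine tendsto_integral_of_dominated_convergence (fun _ => C) (fun N => ?_)
    (integrable_const _) (fun N => ae_of_all _ fun r => hC _ ⟨zero_le, tsub_le_self⟩) ?_
  · exact ((measurable_of_countable fun k : ℕ => B n ω - B (n - (k : ℝ≥0) / N) ω).comp
      (measurable_gridLag N n)).aestronglyMeasurable
  · filter_upwards [ae_pos_expMeasure θ] with r hr
    have h1 : Tendsto (fun N : ℕ => (gridLag N n r : ℝ≥0) / N) atTop (𝓝 (min r.toNNReal n)) := by
      rw [← NNReal.tendsto_coe]
      simpa [hr.le] using tendsto_gridLag_div n hr.le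
    -- Capping the lag at `n` changes nothing, since subtraction in `ℝ≥0` already truncates at `0`.
    have h2 : (n : ℝ≥0) - r.toNNReal = n - min r.toNNReal n := by
      rcases le_total r.toNNReal n with h | h
      · rw [min_eq_left h]
      · rw [min_eq_right h, tsub_eq_zero_of_le h, tsub_self]
    rw [h2]
    exact ((hc.tendsto _).comp (tendsto_const_nhds.sub h1)).const_sub _

variable [MeasurableSpace Ω] {P : Measure Ω} {H K θ : ℝ} {B : ℝ≥0 → Ω → ℝ}

theorem isGaussianProcess_ouApprox (hB : IsGaussianProcess B P) (θ : ℝ) (N : ℕ) :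
    IsGaussianProcess (ouApprox θ B N) P := by
  classical
  refine hB.of_isGaussianProcess fun n => ?_
  set I : Finset ℝ≥0 := insert (n : ℝ≥0)
    ((Finset.range (n * N + 1)).image fun k : ℕ => (n : ℝ≥0) - (k : ℝ≥0) / N)
  let e : ℝ≥0 → (I → ℝ) →L[ℝ] ℝ := fun t =>
    if h : t ∈ I then ContinuousLinearMap.proj (⟨t, h⟩ : I) else 0
  have he : ∀ t ∈ I, ∀ ω, e t (I.restrict (B · ω)) = B t ω := fun t ht ω => by
    simp [e, ht]
  refine ⟨I, ∑ k ∈ Finset.range (n * N + 1), (expMeasure θ).real (gridLag N n ⁻¹' {k}) •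
    (e n - e (n - (k : ℝ≥0) / N)), fun ω => ?_⟩
  rw [sum_apply]
  refine Finset.sum_congr rfl fun k hk => ?_
  rw [smul_apply, sub_apply, smul_eq_mul,
    he _ (Finset.mem_insert_self _ _),
    he _ (Finset.mem_insert_of_mem (Finset.mem_image_of_mem _ hk))]

theorem IsBifractionalBM.integral_ouApprox (hB : IsBifractionalBM P H K B) (θ : ℝ) (N n : ℕ) :
    ∫ ω, ouApprox θ B N n ω ∂P = 0 := by
  have hi : ∀ t, Integrable (B t) P := fun t => (hB.isGaussian.hasGaussianLaw_eval t).integrable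
  unfold ouApprox
  rw [integral_finsetSum _ fun k _ => ((hi _).sub_fun (hi _)).const_mul _]
  refine Finset.sum_eq_zero fun k _ => ?_
  rw [integral_const_mul, integral_sub (hi _) (hi _), hB.mean_zero, hB.mean_zero, sub_zero,
    mul_zero]

theorem IsBifractionalBM.integral_ouApprox_mul (hB : IsBifractionalBM P H K B) (hθ : 0 < θ)
    (N i j : ℕ) :
    ∫ ω, ouApprox θ B N i ω * ouApprox θ B N j ω ∂P =
      ∫ z : ℝ × ℝ, rectIncr (bifracCov H K) i j (gridLag N i z.1 / N) (gridLag N j z.2 / N)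
        ∂((expMeasure θ).prod (expMeasure θ)) := by
  have := isProbabilityMeasure_expMeasure hθ
  rw [integral_prod_comp_nat_eq_sum (measurable_gridLag N i) (measurable_gridLag N j)
    (gridLag_le N i) (gridLag_le N j)
    (fun k l => rectIncr (bifracCov H K) i j ((k : ℝ) / N) ((l : ℝ) / N))]
  have hi : ∀ s u t v : ℝ≥0, Integrable (fun ω => (B s ω - B u ω) * (B t ω - B v ω)) P :=
    fun s u t v => (hB.isGaussian.hasGaussianLaw_fun_sub (s := s) (t := u)).memLp_two.integrable_mul
      (hB.isGaussian.hasGaussianLaw_fun_sub (s := t) (t := v)).memLp_two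
  simp only [ouApprox, Finset.sum_mul_sum, mul_mul_mul_comm _ (B i _ - _)]
  rw [integral_finsetSum _ fun k _ => integrable_finsetSum _ fun l _ => (hi _ _ _ _).const_mul _]
  refine Finset.sum_congr rfl fun k hk => ?_
  rw [integral_finsetSum _ fun l _ => (hi _ _ _ _).const_mul _]
  refine Finset.sum_congr rfl fun l hl => ?_
  -- The cap `k ≤ n * N` makes the truncated subtraction a genuine one, so the lag is exactly `k /
  -- N`.
  have hc : ∀ n k : ℕ, k ∈ Finset.range (n * N + 1) →
      (((n : ℝ≥0) : ℝ) - ((n - (k : ℝ≥0) / N : ℝ≥0) : ℝ)) = (k : ℝ) / N := fun n k hk => by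
    have hk' : (k : ℝ) / N ≤ n := div_le_of_le_mul_natCast (Nat.lt_succ_iff.1 (Finset.mem_range.1 hk))
    rw [NNReal.coe_sub (by exact_mod_cast hk')]
    simp
  rw [integral_const_mul, hB.integral_incr_mul_incr, hc i k hk, hc j l hl]
  simp

end Discretization

/-! ### Double sums with polynomial decay, and a strong law. -/

section Averages

/-- Bernoulli's inequality gives `h (n+1)^(h-1) ≤ (n+1)^h - n^h`, which telescopes. -/
theorem sum_range_rpow_sub_one_le {h : ℝ} (hh : 0 < h ∧ h < 1) (n : ℕ) :
    ∑ i ∈ Finset.range n, ((i : ℝ) + 1) ^ (h - 1) ≤ (n : ℝ) ^ h / h := by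
  induction n with
  | zero => simp [Real.zero_rpow hh.1.ne']
  | succ n ih =>
    rw [Finset.sum_range_succ, Nat.cast_add_one]
    have hn : (0 : ℝ) < n + 1 := by positivity
    have hb : (1 + -1 / ((n : ℝ) + 1)) ^ h ≤ 1 + h * (-1 / ((n : ℝ) + 1)) :=
      rpow_one_add_le_one_add_mul_self (by rw [le_div_iff₀ hn]; linarith [n.cast_nonneg (α := ℝ)])
        hh.1.le hh.2.le
    have e : 1 + -1 / ((n : ℝ) + 1) = n / (n + 1) := by field_simp; ring
    rw [e, Real.div_rpow n.cast_nonneg hn.le, div_le_iff₀ (Real.rpow_pos_of_pos hn h)] at hb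
    have e2 : ((n : ℝ) + 1) ^ (h - 1) = (n + 1) ^ h / (n + 1) := by
      rw [Real.rpow_sub hn, Real.rpow_one]
    have e3 : (1 + h * (-1 / ((n : ℝ) + 1))) * (n + 1) ^ h =
        (n + 1) ^ h - h * ((n + 1) ^ h / (n + 1)) := by ring
    rw [e3] at hb
    rw [e2]
    rw [le_div_iff₀ hh.1] at ih ⊢
    nlinarith

/-- Passing from `n` to `n + 1` adds a row and a column, each at most `2 C n^h / h`, and one
diagonal term at most `C`; hence the constant `4 / h + 1`. -/
theorem sum_sum_le_of_decay {F : ℕ → ℕ → ℝ} {C h : ℝ} (hh : 0 < h ∧ h < 1)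
    (hC : 0 ≤ C) (hsymm : ∀ i j, F i j = F j i) (hdiag : ∀ i, F i i ≤ C)
    (hoff : ∀ i j : ℕ, i < j →
      F i j ≤ C * (((j : ℝ) - i) ^ (h - 1) + ((i : ℝ) + 1) ^ (h - 1))) (n : ℕ) :
    ∑ i ∈ Finset.range n, ∑ j ∈ Finset.range n, F i j ≤
      C * (4 / h + 1) * (n * (n : ℝ) ^ h) := by
  induction n with
  | zero => simp
  | succ n ih =>
    have h0 := hh.1
    have hrow : ∑ i ∈ Finset.range n, F i n ≤ C * (2 * ((n : ℝ) ^ h / h)) := by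
      calc ∑ i ∈ Finset.range n, F i n
          ≤ ∑ i ∈ Finset.range n,
              C * (((n : ℝ) - i) ^ (h - 1) + ((i : ℝ) + 1) ^ (h - 1)) :=
            Finset.sum_le_sum fun i hi => hoff i n (Finset.mem_range.1 hi)
        _ = C * (2 * ∑ i ∈ Finset.range n, ((i : ℝ) + 1) ^ (h - 1)) := by
            have e : ∑ i ∈ Finset.range n, ((n : ℝ) - i) ^ (h - 1) =
                ∑ i ∈ Finset.range n, ((i : ℝ) + 1) ^ (h - 1) := by
              rw [← Finset.sum_range_reflect]
              refine Finset.sum_congr rfl fun i hi => ?_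
              have hi' := Finset.mem_range.1 hi
              rw [Nat.sub_sub, Nat.cast_sub (by omega)]
              push_cast
              congr 1; ring
            rw [← Finset.mul_sum, Finset.sum_add_distrib, e, two_mul]
        _ ≤ _ := by
            have := sum_range_rpow_sub_one_le hh n
            gcongr
    have hn : (n : ℝ) ^ h ≤ ((n : ℝ) + 1) ^ h :=
      Real.rpow_le_rpow n.cast_nonneg (by linarith) h0.le
    have hn1 : 1 ≤ ((n : ℝ) + 1) ^ h :=
      Real.one_le_rpow (by linarith [n.cast_nonneg (α := ℝ)]) h0.le
    simp only [Finset.sum_range_succ, Finset.sum_add_distrib]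
    rw [Finset.sum_congr rfl fun j (_ : j ∈ Finset.range n) => hsymm n j, Nat.cast_add_one]
    calc _ ≤ C * (4 / h + 1) * (n * (n : ℝ) ^ h) + C * (2 * ((n : ℝ) ^ h / h)) +
          (C * (2 * ((n : ℝ) ^ h / h)) + C) := by gcongr; exact hdiag n
      _ = C * (4 / h + 1) * (n * (n : ℝ) ^ h) + C * (4 / h * (n : ℝ) ^ h + 1) := by ring
      _ ≤ C * (4 / h + 1) * (n * ((n : ℝ) + 1) ^ h) +
          C * (4 / h * ((n : ℝ) + 1) ^ h + ((n : ℝ) + 1) ^ h) := by gcongr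
      _ = _ := by ring

theorem eventually_succ_pow_le_mul (q : ℕ) {a : ℝ} (ha : 1 < a) :
    ∀ᶠ k : ℕ in atTop, (((k + 1 + 1) ^ q : ℕ) : ℝ) ≤ a * ((k + 1) ^ q : ℕ) := by
  have h1 : Tendsto (fun k : ℕ => (1 + 1 / ((k : ℝ) + 1)) ^ q) atTop (𝓝 1) := by
    simpa using (tendsto_one_div_add_atTop_nhds_zero_nat.const_add (1 : ℝ)).pow q
  filter_upwards [h1.eventually (gt_mem_nhds ha)] with k hk
  have hk0 : (0 : ℝ) < (k : ℝ) + 1 := by positivity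
  push_cast
  calc ((k : ℝ) + 1 + 1) ^ q = (1 + 1 / ((k : ℝ) + 1)) ^ q * (k + 1) ^ q := by
        rw [← mul_pow]; congr 1; field_simp
    _ ≤ a * (k + 1) ^ q := by gcongr

variable {Ω : Type*} [MeasurableSpace Ω] {P : Measure Ω}

/-- A strong law of large numbers for nonnegative variables under a polynomial second moment
bound. -/
theorem ae_tendsto_average_of_lintegral_sq_le {Z : ℕ → Ω → ℝ} {v : ℕ → ℝ} {l C h : ℝ}
    (hh : h < 1) (hZ : ∀ i, AEMeasurable (Z i) P) (hZ0 : ∀ i ω, 0 ≤ Z i ω)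
    (hv : Tendsto v atTop (𝓝 l))
    (hb : ∀ n : ℕ, ∫⁻ ω, ENNReal.ofReal ((∑ i ∈ Finset.range n, (Z i ω - v i)) ^ 2) ∂P ≤
      ENNReal.ofReal (C * (n * (n : ℝ) ^ h))) :
    ∀ᵐ ω ∂P, Tendsto (fun n : ℕ => (∑ i ∈ Finset.range n, Z i ω) / n) atTop (𝓝 l) := by
  -- With `q (1 - h) > 2`, the second moments along `c k = (k+1)^q` are `O((k+1)^(-2))`, hence
  -- summable.
  obtain ⟨q, hq⟩ := exists_nat_gt (2 / (1 - h))
  have hh' : 0 < 1 - h := by linarith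
  have hq2 : 2 < q * (1 - h) := by rwa [div_lt_iff₀ hh'] at hq
  have hq0 : q ≠ 0 := by
    rintro rfl
    simp at hq2; linarith
  set c : ℕ → ℕ := fun k => (k + 1) ^ q with hc
  have hcpos : ∀ k, (0 : ℝ) < c k := fun k => by simp only [hc]; positivity
  set D : ℕ → Ω → ℝ := fun k ω => (∑ i ∈ Finset.range (c k), (Z i ω - v i)) / c k with hD
  have hDm : ∀ k, AEMeasurable (fun ω => ENNReal.ofReal (D k ω ^ 2)) P := fun k =>
    (((Finset.aemeasurable_fun_sum _ fun i _ => (hZ i).sub_const _).div_const _).pow_const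
      2).ennreal_ofReal
  have hDb : ∀ k, ∫⁻ ω, ENNReal.ofReal (D k ω ^ 2) ∂P ≤
      ENNReal.ofReal (|C| * ((((k + 1 : ℕ) : ℝ) ^ 2)⁻¹)) := fun k => by
    have e : ∀ ω, ENNReal.ofReal (D k ω ^ 2) = ENNReal.ofReal (((c k : ℝ) ^ 2)⁻¹) *
        ENNReal.ofReal ((∑ i ∈ Finset.range (c k), (Z i ω - v i)) ^ 2) := fun ω => by
      rw [← ENNReal.ofReal_mul (by positivity), hD, div_pow, div_eq_inv_mul]
    simp only [e]
    rw [lintegral_const_mul' _ _ ENNReal.ofReal_ne_top]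
    refine (mul_le_mul_right (hb (c k)) _).trans ?_
    rw [← ENNReal.ofReal_mul (by positivity)]
    refine ENNReal.ofReal_le_ofReal ?_
    have hk1 : (1 : ℝ) ≤ ((k + 1 : ℕ) : ℝ) := by exact_mod_cast Nat.le_add_left 1 k
    have hk0 : (0 : ℝ) < ((k + 1 : ℕ) : ℝ) := by linarith
    have e2 : ((c k : ℝ) ^ 2)⁻¹ * (C * (c k * (c k : ℝ) ^ h)) = C * (c k : ℝ) ^ (h - 1) := by
      rw [Real.rpow_sub (hcpos k), Real.rpow_one]
      have := (hcpos k).ne'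
      field_simp
    have e3 : (c k : ℝ) ^ (h - 1) ≤ (((k + 1 : ℕ) : ℝ) ^ 2)⁻¹ := by
      simp only [hc, Nat.cast_pow]
      rw [← Real.rpow_natCast, ← Real.rpow_mul hk0.le, ← Real.rpow_two, ← Real.rpow_neg hk0.le]
      exact Real.rpow_le_rpow_of_exponent_le hk1 (by nlinarith)
    rw [e2]
    have := hcpos k
    exact mul_le_mul (le_abs_self C) e3 (by positivity) (abs_nonneg _)
  have hsum : ∑' k, ENNReal.ofReal (|C| * ((((k + 1 : ℕ) : ℝ) ^ 2)⁻¹)) ≠ ⊤ := by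
    have hs : Summable fun k : ℕ => |C| * ((((k + 1 : ℕ) : ℝ) ^ 2)⁻¹) :=
      ((summable_nat_add_iff 1).2 (Real.summable_nat_pow_inv.2 one_lt_two)).mul_left _
    rw [← ENNReal.ofReal_tsum_of_nonneg (fun k => by positivity) hs]
    exact ENNReal.ofReal_ne_top
  have hae : ∀ᵐ ω ∂P, ∑' k, ENNReal.ofReal (D k ω ^ 2) < ⊤ := by
    refine ae_lt_top' (AEMeasurable.tsum hDm) ?_
    rw [lintegral_tsum hDm]
    exact ne_top_of_le_ne_top hsum (ENNReal.tsum_le_tsum hDb)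
  filter_upwards [hae] with ω hω
  have hD0 : Tendsto (fun k => D k ω) atTop (𝓝 0) := by
    have h1 := ENNReal.tendsto_atTop_zero_of_tsum_ne_top hω.ne
    have h2 := (ENNReal.tendsto_toReal ENNReal.zero_ne_top).comp h1
    have h3 : Tendsto (fun k => D k ω ^ 2) atTop (𝓝 0) := by
      refine h2.congr fun k => ?_
      simp [ENNReal.toReal_ofReal (sq_nonneg (D k ω))]
    have h4 := h3.sqrt
    simp only [Real.sqrt_sq_eq_abs, Real.sqrt_zero] at h4
    exact (tendsto_zero_iff_abs_tendsto_zero _).2 h4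
  have hct : Tendsto c atTop atTop :=
    (tendsto_pow_atTop hq0).comp (tendsto_add_atTop_nat 1)
  -- Nonnegativity makes the partial sums monotone, so convergence along a subsequence with
  -- consecutive ratios tending to `1` suffices.
  refine tendsto_div_of_monotone_of_exists_subseq_tendsto_div
    (fun n => ∑ i ∈ Finset.range n, Z i ω) l ?_ fun a ha => ⟨c, ?_, hct, ?_⟩
  · exact monotone_nat_of_le_succ fun n => by
      rw [Finset.sum_range_succ]; exact le_add_of_nonneg_right (hZ0 n ω)
  · exact eventually_succ_pow_le_mul q ha
  · have h5 := hD0.add ((hv.cesaro).comp hct)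
    rw [zero_add] at h5
    refine h5.congr fun k => ?_
    simp only [hD, Function.comp_apply, Finset.sum_sub_distrib]
    rw [inv_mul_eq_div, ← add_div, sub_add_cancel]

end Averages

/-! ### Moments of the process and of the estimator. -/

section Estimator

theorem quadraticEstimator_eq {Ω : Type*} (X : ℝ≥0 → Ω → ℝ) (n : ℕ) (ω : Ω) :
    quadraticEstimator X n ω = (∑ i ∈ Finset.range n, X ((i + 1 : ℕ) : ℝ≥0) ω ^ 2) / n := by
  rw [quadraticEstimator, one_div, inv_mul_eq_div, Finset.range_eq_Ico,
    Finset.sum_Ico_add' (fun i : ℕ => X (i : ℝ≥0) ω ^ 2) 0 n 1]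
  rfl

theorem measurable_comp_gridLag (f : ℕ → ℕ → ℝ) (N n : ℕ) :
    Measurable fun z : ℝ × ℝ => f (gridLag N n z.1) (gridLag N n z.2) :=
  (measurable_of_countable fun q : ℕ × ℕ => f q.1 q.2).comp
    (((measurable_gridLag N n).comp measurable_fst).prodMk
      ((measurable_gridLag N n).comp measurable_snd))

variable {Ω : Type*} [MeasurableSpace Ω] {P : Measure Ω} {H K θ : ℝ} {B X : ℝ≥0 → Ω → ℝ}

theorem mul_mem_Ioo (hH : 0 < H ∧ H < 1) (hK : 0 < K ∧ K < 1) : 0 < H * K ∧ H * K < 1 :=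
  ⟨mul_pos hH.1 hK.1, by nlinarith [hH.1, hH.2, hK.1, hK.2]⟩

theorem IsBifractionalBM.abs_rectIncr_le_rpow (hB : IsBifractionalBM P H K B) (hH : 0 < H)
    (hK : 0 < K ∧ K < 1) {s t r r' : ℝ} (hr : 0 ≤ r) (hr' : 0 ≤ r') (hrs : r ≤ s) (hrt : r' ≤ t) :
    |rectIncr (bifracCov H K) s t r r'| ≤ r ^ (2 * H * K) + r' ^ (2 * H * K) := by
  have h := hB.abs_rectIncr_le hH hK ⟨s, hr.trans hrs⟩ ⟨s - r, sub_nonneg.2 hrs⟩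
    ⟨t, hr'.trans hrt⟩ ⟨t - r', sub_nonneg.2 hrt⟩
  change |rectIncr (bifracCov H K) s t (s - (s - r)) (t - (t - r'))| ≤
    |s - (s - r)| ^ (2 * H * K) + |t - (t - r')| ^ (2 * H * K) at h
  rwa [sub_sub_cancel, sub_sub_cancel, abs_of_nonneg hr, abs_of_nonneg hr'] at h

/-- Polynomial weight dominating the covariances of lagged increments. -/
def lagWeight (z : ℝ × ℝ) : ℝ := (1 + z.1) ^ 3 * (1 + z.2) ^ 3

theorem integrable_lagWeight (hθ : 0 < θ) :
    Integrable lagWeight ((expMeasure θ).prod (expMeasure θ)) := by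
  have := isProbabilityMeasure_expMeasure hθ
  exact (integrable_one_add_pow_expMeasure hθ 3).mul_prod (integrable_one_add_pow_expMeasure hθ 3)

theorem integral_lagWeight_nonneg (hθ : 0 < θ) :
    0 ≤ ∫ z, lagWeight z ∂((expMeasure θ).prod (expMeasure θ)) := by
  refine integral_nonneg_of_ae ?_
  filter_upwards [ae_nonneg_prod_expMeasure hθ] with z ⟨h1, h2⟩
  unfold lagWeight
  positivity

theorem lagWeight_mono {r r' : ℝ} {z : ℝ × ℝ} (hr : 0 ≤ r) (hr' : 0 ≤ r') (h1 : r ≤ z.1)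
    (h2 : r' ≤ z.2) : (1 + r) ^ 3 * (1 + r') ^ 3 ≤ lagWeight z := by
  have h3 : 0 ≤ 1 + z.1 := by linarith
  unfold lagWeight
  gcongr

theorem IsBifractionalBM.abs_rectIncr_le_lagWeight (hB : IsBifractionalBM P H K B)
    (hH : 0 < H ∧ H < 1) (hK : 0 < K ∧ K < 1) {s t r r' : ℝ} {z : ℝ × ℝ} (hr : 0 ≤ r)
    (hr' : 0 ≤ r') (hrs : r ≤ s) (hrt : r' ≤ t) (h1 : r ≤ z.1) (h2 : r' ≤ z.2) :
    |rectIncr (bifracCov H K) s t r r'| ≤ 2 * lagWeight z := by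
  obtain ⟨h0, h0'⟩ := mul_mem_Ioo hH hK
  have hb := (hB.abs_rectIncr_le_rpow hH.1 hK hr hr' hrs hrt).trans
    (rpow_add_rpow_le (p := 2 * H * K) ⟨by linarith, by linarith⟩ hr hr')
  refine hb.trans ?_
  have e1 : (1 + r) ^ 2 ≤ (1 + r) ^ 3 := pow_le_pow_right₀ (by linarith) (by norm_num)
  have e2 : (1 + r') ^ 2 ≤ (1 + r') ^ 3 := pow_le_pow_right₀ (by linarith) (by norm_num)
  calc 2 * (1 + r) ^ 2 * (1 + r') ^ 2 = 2 * ((1 + r) ^ 2 * (1 + r') ^ 2) := by ring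
    _ ≤ 2 * ((1 + r) ^ 3 * (1 + r') ^ 3) := by gcongr
    _ ≤ _ := by gcongr; exact lagWeight_mono hr hr' h1 h2

theorem abs_integral_le_mul_integral_lagWeight (hθ : 0 < θ) {f : ℝ × ℝ → ℝ} {c : ℝ}
    (hf : ∀ z : ℝ × ℝ, 0 ≤ z.1 → 0 ≤ z.2 → |f z| ≤ c * lagWeight z) :
    |∫ z, f z ∂((expMeasure θ).prod (expMeasure θ))| ≤
      c * ∫ z, lagWeight z ∂((expMeasure θ).prod (expMeasure θ)) := by
  rw [← integral_const_mul, ← Real.norm_eq_abs]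
  refine norm_integral_le_of_norm_le ((integrable_lagWeight hθ).const_mul c) ?_
  filter_upwards [ae_nonneg_prod_expMeasure hθ] with z hz
  exact hf z hz.1 hz.2

theorem IsBifractionalBM.abs_cov_ouApprox_le (hB : IsBifractionalBM P H K B)
    (hH : 0 < H ∧ H < 1) (hK : 0 < K ∧ K < 1) (hθ : 0 < θ) (N i j : ℕ) :
    |∫ ω, ouApprox θ B N i ω * ouApprox θ B N j ω ∂P| ≤
      2 * ∫ z, lagWeight z ∂((expMeasure θ).prod (expMeasure θ)) := by
  rw [hB.integral_ouApprox_mul hθ]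
  exact abs_integral_le_mul_integral_lagWeight hθ fun z h1 h2 =>
    hB.abs_rectIncr_le_lagWeight hH hK (by positivity) (by positivity)
      (div_le_of_le_mul_natCast (gridLag_le N i _)) (div_le_of_le_mul_natCast (gridLag_le N j _))
      (gridLag_div_le_self N i h1) (gridLag_div_le_self N j h2)

theorem IsBifractionalBM.abs_cov_ouApprox_le_decay (hB : IsBifractionalBM P H K B)
    (hH : 0 < H ∧ H < 1) (hK : 0 < K ∧ K < 1) (hθ : 0 < θ) (N : ℕ) {i j : ℕ} (hi : 1 ≤ i)
    (hij : i < j) :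
    |∫ ω, ouApprox θ B N i ω * ouApprox θ B N j ω ∂P| ≤
      16 * (((j : ℝ) - i) ^ (H * K - 1) + (i : ℝ) ^ (H * K - 1)) *
        ∫ z, lagWeight z ∂((expMeasure θ).prod (expMeasure θ)) := by
  have hi' : (1 : ℝ) ≤ i := by exact_mod_cast hi
  have hij' : (i : ℝ) + 1 ≤ j := by exact_mod_cast hij
  have hd0 : 0 ≤ ((j : ℝ) - i) ^ (H * K - 1) := Real.rpow_nonneg (by linarith) _
  rw [hB.integral_ouApprox_mul hθ]
  refine abs_integral_le_mul_integral_lagWeight hθ fun z h1 h2 => ?_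
  have g1 := div_le_of_le_mul_natCast (gridLag_le N i z.1)
  have g2 := div_le_of_le_mul_natCast (gridLag_le N j z.2)
  refine (abs_rectIncr_bifracCov_le_decay hH hK hi' hij' (by positivity) (by positivity)
    (hB.abs_rectIncr_le_rpow hH.1 hK (by positivity) (by positivity) g1 g2)).trans ?_
  gcongr
  exact lagWeight_mono (by positivity) (by positivity) (gridLag_div_le_self N i h1)
    (gridLag_div_le_self N j h2)

/-- The variance of the Ornstein-Uhlenbeck process at time `n`. -/
noncomputable def ouVariance (H K θ : ℝ) (n : ℕ) : ℝ :=
  ∫ z : ℝ × ℝ, rectIncr (bifracCov H K) n n (min z.1 n) (min z.2 n)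
    ∂((expMeasure θ).prod (expMeasure θ))

theorem continuous_rectIncr_bifracCov (hH : 0 < H) (hK : 0 < K) (s t : ℝ) :
    Continuous fun z : ℝ × ℝ => rectIncr (bifracCov H K) s t z.1 z.2 := by
  have h1 : 0 ≤ 2 * H := by positivity
  have h2 : 0 ≤ 2 * H * K := by positivity
  have h3 := hK.le
  unfold rectIncr bifracCov
  fun_prop (disch := assumption)

theorem IsBifractionalBM.tendsto_variance_ouApprox (hB : IsBifractionalBM P H K B)
    (hH : 0 < H ∧ H < 1) (hK : 0 < K ∧ K < 1) (hθ : 0 < θ) (n : ℕ) :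
    Tendsto (fun N => ∫ ω, ouApprox θ B N n ω ^ 2 ∂P) atTop (𝓝 (ouVariance H K θ n)) := by
  have hc := continuous_rectIncr_bifracCov hH.1 hK.1 n n
  simp only [pow_two, hB.integral_ouApprox_mul hθ]
  refine tendsto_integral_of_dominated_convergence (fun z => 2 * lagWeight z) (fun N => ?_)
    ((integrable_lagWeight hθ).const_mul 2) (fun N => ?_) ?_
  · exact (measurable_comp_gridLag (fun k l => rectIncr (bifracCov H K) n n ((k : ℝ) / N)
      ((l : ℝ) / N)) N n).aestronglyMeasurable
  · filter_upwards [ae_nonneg_prod_expMeasure hθ] with z ⟨h1, h2⟩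
    exact hB.abs_rectIncr_le_lagWeight hH hK (by positivity) (by positivity)
      (div_le_of_le_mul_natCast (gridLag_le N n _)) (div_le_of_le_mul_natCast (gridLag_le N n _))
      (gridLag_div_le_self N n h1) (gridLag_div_le_self N n h2)
  · filter_upwards [ae_nonneg_prod_expMeasure hθ] with z ⟨h1, h2⟩
    have hg := (tendsto_gridLag_div n h1).prodMk_nhds (tendsto_gridLag_div n h2)
    have hcz := hc.tendsto (min z.1 (n : ℝ), min z.2 (n : ℝ))
    simpa only [Function.comp_def] using hcz.comp hg

theorem IsBifractionalBM.tendsto_ouVariance (hB : IsBifractionalBM P H K B)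
    (hH : 0 < H ∧ H < 1) (hK : 0 < K ∧ K < 1) (hθ : 0 < θ) :
    Tendsto (ouVariance H K θ) atTop (𝓝 (asymptoticVarianceHK H K θ)) := by
  have hp : 0 < 2 * H * K := by have := (mul_mem_Ioo hH hK).1; linarith
  have e : asymptoticVarianceHK H K θ = ∫ z : ℝ × ℝ, 1 / (2 : ℝ) ^ K *
      (z.1 ^ (2 * H * K) + z.2 ^ (2 * H * K) - |z.1 - z.2| ^ (2 * H * K))
        ∂((expMeasure θ).prod (expMeasure θ)) := by
    rw [integral_const_mul, integral_rpow_add_sub_expMeasure hθ hp, asymptoticVarianceHK,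
      Real.rpow_sub two_pos, Real.rpow_one]
    ring
  rw [e]
  refine tendsto_integral_of_dominated_convergence (fun z => 2 * lagWeight z) (fun n => ?_)
    ((integrable_lagWeight hθ).const_mul 2) (fun n => ?_) ?_
  · exact ((continuous_rectIncr_bifracCov hH.1 hK.1 n n).comp
      (by fun_prop : Continuous fun z : ℝ × ℝ => (min z.1 (n : ℝ), min z.2 (n : ℝ)))).aestronglyMeasurable
  · filter_upwards [ae_nonneg_prod_expMeasure hθ] with z ⟨h1, h2⟩
    exact hB.abs_rectIncr_le_lagWeight hH hK (le_min h1 n.cast_nonneg) (le_min h2 n.cast_nonneg)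
      (min_le_right _ _) (min_le_right _ _) (min_le_left _ _) (min_le_left _ _)
  · filter_upwards [ae_nonneg_prod_expMeasure hθ] with z ⟨h1, h2⟩
    refine (tendsto_rectIncr_bifracCov_diag hH hK h1 h2).congr' ?_
    filter_upwards [eventually_ge_atTop ⌈z.1 + z.2⌉₊] with n hn
    have hn' : z.1 + z.2 ≤ n := Nat.ceil_le.1 hn
    rw [min_eq_left (by linarith), min_eq_left (by linarith)]

theorem IsBifractionalBM.integral_sum_centered_sq_ouApprox_le (hB : IsBifractionalBM P H K B)
    (hH : 0 < H ∧ H < 1) (hK : 0 < K ∧ K < 1) (hθ : 0 < θ) (N n : ℕ) :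
    ∫ ω, (∑ i ∈ Finset.range n, (ouApprox θ B N (i + 1) ω ^ 2 -
        ∫ ω, ouApprox θ B N (i + 1) ω ^ 2 ∂P)) ^ 2 ∂P ≤
      64 * (∫ z, lagWeight z ∂((expMeasure θ).prod (expMeasure θ))) ^ 2 *
        (4 / (H * K) + 1) * (n * (n : ℝ) ^ (H * K)) := by
  have hG : IsGaussianProcess (fun i : ℕ => ouApprox θ B N (i + 1)) P :=
    (isGaussianProcess_ouApprox hB.isGaussian θ N).comp_right fun i => i + 1
  have hM := integral_lagWeight_nonneg hθ
  rw [hG.integral_sum_centered_sq (fun i => hB.integral_ouApprox θ N (i + 1))]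
  have hcov := hB.abs_cov_ouApprox_le hH hK hθ N
  have hdec := fun i j => hB.abs_cov_ouApprox_le_decay hH hK hθ N (i := i) (j := j)
  set M := ∫ z, lagWeight z ∂((expMeasure θ).prod (expMeasure θ))
  refine sum_sum_le_of_decay (mul_mem_Ioo hH hK) (by positivity) (fun i j => ?_) (fun i => ?_)
    (fun i j hij => ?_) n
  · simp only [mul_comm]
  · have h1 := hcov (i + 1) (i + 1)
    rw [← sq_abs]
    nlinarith [abs_nonneg (∫ ω, ouApprox θ B N (i + 1) ω * ouApprox θ B N (i + 1) ω ∂P)]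
  · have h1 := hcov (i + 1) (j + 1)
    have h2 := hdec (i + 1) (j + 1) (by omega) (by omega)
    push_cast at h2
    rw [add_sub_add_right_eq_sub] at h2
    rw [← sq_abs, pow_two]
    -- Decay is spent on only one of the two covariance factors, the other being bounded by `2 * M`;
    -- the constant is `2 · 2 · 16 = 64`.
    calc 2 * (|∫ ω, ouApprox θ B N (i + 1) ω * ouApprox θ B N (j + 1) ω ∂P| *
          |∫ ω, ouApprox θ B N (i + 1) ω * ouApprox θ B N (j + 1) ω ∂P|)
        ≤ 2 * ((2 * M) * (16 * (((j : ℝ) - i) ^ (H * K - 1) + ((i : ℝ) + 1) ^ (H * K - 1)) * M)) := by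
          gcongr
      _ = _ := by ring

/-- Fatou's lemma: the bound for the approximants does not depend on `N`, and their centred sums of
squares converge almost surely. No Gaussianity of `X` itself is needed. -/
theorem IsBifractionalBM.lintegral_sum_centered_sq_le (hB : IsBifractionalBM P H K B)
    (hX : IsOUProcess P θ B X) (hH : 0 < H ∧ H < 1) (hK : 0 < K ∧ K < 1) (hθ : 0 < θ) (n : ℕ) :
    ∫⁻ ω, ENNReal.ofReal ((∑ i ∈ Finset.range n, (X ((i + 1 : ℕ) : ℝ≥0) ω ^ 2 -
        ouVariance H K θ (i + 1))) ^ 2) ∂P ≤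
      ENNReal.ofReal (64 * (∫ z, lagWeight z ∂((expMeasure θ).prod (expMeasure θ))) ^ 2 *
        (4 / (H * K) + 1) * (n * (n : ℝ) ^ (H * K))) := by
  set S : ℕ → Ω → ℝ := fun N ω => (∑ i ∈ Finset.range n, (ouApprox θ B N (i + 1) ω ^ 2 -
    ∫ ω, ouApprox θ B N (i + 1) ω ^ 2 ∂P)) ^ 2 with hS
  have hG : ∀ N, IsGaussianProcess (fun i : ℕ => ouApprox θ B N (i + 1)) P := fun N =>
    (isGaussianProcess_ouApprox hB.isGaussian θ N).comp_right fun i => i + 1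
  have hSi : ∀ N, Integrable (S N) P := fun N => (hG N).integrable_sum_centered_sq _ _
  have hlim : ∀ᵐ ω ∂P, ENNReal.ofReal ((∑ i ∈ Finset.range n, (X ((i + 1 : ℕ) : ℝ≥0) ω ^ 2 -
      ouVariance H K θ (i + 1))) ^ 2) = liminf (fun N => ENNReal.ofReal (S N ω)) atTop := by
    filter_upwards [hX] with ω hω
    refine (Tendsto.liminf_eq (ENNReal.tendsto_ofReal ?_)).symm
    exact (tendsto_finsetSum _ fun i _ => ((tendsto_ouApprox hθ hω (i + 1)).pow 2).sub
      (hB.tendsto_variance_ouApprox hH hK hθ (i + 1))).pow 2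
  rw [lintegral_congr_ae hlim]
  refine (lintegral_liminf_le' fun N => (hSi N).aemeasurable.ennreal_ofReal).trans ?_
  refine liminf_le_of_le (by isBoundedDefault) fun b hb => ?_
  obtain ⟨N, hN⟩ := hb.exists
  refine hN.trans ?_
  rw [← ofReal_integral_eq_lintegral_ofReal (hSi N) (ae_of_all _ fun ω => sq_nonneg _)]
  exact ENNReal.ofReal_le_ofReal (hB.integral_sum_centered_sq_ouApprox_le hH hK hθ N n)

/-- Measurability of `X` is inherited from the approximants, as an almost sure limit. -/
theorem aemeasurable_of_isOUProcess (hB : IsGaussianProcess B P) (hX : IsOUProcess P θ B X)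
    (hθ : 0 < θ) (n : ℕ) : AEMeasurable (X n) P :=
  aemeasurable_of_tendsto_metrizable_ae atTop
    (fun N => (isGaussianProcess_ouApprox hB θ N).aemeasurable n)
    (by filter_upwards [hX] with ω hω using tendsto_ouApprox hθ hω n)

end Estimator

theorem mainTheorem7 {Ω : Type*} [MeasurableSpace Ω] (P : Measure Ω) [IsProbabilityMeasure P]
    (H K θ : ℝ) (hH : 0 < H ∧ H < 1) (hK : 0 < K ∧ K < 1) (hθ : 0 < θ)
    (B X : ℝ≥0 → Ω → ℝ) (hB : IsBifractionalBM P H K B) (hX : IsOUProcess P θ B X) :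
    ∀ᵐ ω ∂P, Tendsto (fun n : ℕ => quadraticEstimator X n ω) atTop
      (𝓝 (asymptoticVarianceHK H K θ)) := by
  simp only [quadraticEstimator_eq]
  exact ae_tendsto_average_of_lintegral_sq_le (mul_mem_Ioo hH hK).2
    (fun i => (aemeasurable_of_isOUProcess hB.isGaussian hX hθ (i + 1)).pow_const 2)
    (fun i ω => sq_nonneg _) ((hB.tendsto_ouVariance hH hK hθ).comp (tendsto_add_atTop_nat 1))
    (hB.lintegral_sum_centered_sq_le hX hH hK hθ)
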